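/- **Theorem 4.4.** Let $l_1\ge 25$ be a perfect square. Let $\mathcal C_1$ be a set of $N_1=2^{\sqrt{l_1}}$ binary words of length $l_1$, each of which starts with $001$ and contains $00$ only as its prefix. Inductively, order $\mathcal C_j=\{u^{(j)}_1,\dots,u^{(j)}_{N_j}\}$, with $N_j=|\mathcal C_j|$, where the ordering is arbitrary except that for $j\ge 2$ the word $u_1^{(j)}$ is the plain concatenation $u_1^{(j-1)}u_2^{(j-1)}\cdots u_{N_{j-1}}^{(j-1)}$. Put $P_j=\{2\}\cup\{i^2: 2\le i\le\sqrt{N_j}\}$, and let $\mathcal C_{j+1}$ be the set of all words $u^{(j)}_{\pi(1)}u^{(j)}_{\pi(2)}\cdots u^{(j)}_{\pi(N_j)}$, where $\pi$ is a permutation of $\{1,\dots,N_j\}$ fixing every index outside $P_j$. Let $X\subset\{0,1\}^{\mathbb Z}$ be the set of bi-infinite sequences all of whose finite subwords are subwords of words in $\bigcup_j\mathcal C_j$, let $\sigma$ be the left shift, and for $x \in X$ let $P_n(x)=\{y\in X: y_i=x_i \text{ for } 0\le i<n\}$. There is exactly one $\sigma$-invariant Borel probability measure $\mu$ on $X$,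 and the following hold. (1) For $\mu$-a.e. $x\in X$, the function $\beta\mapsto\limsup_{n\to\infty}-\frac1{n^\beta}\log\mu(P_n(x))$ has the critical value $1/2$. (2) There is a set $\hat X\subset X$ of full $\mu$-measure such that for every $\tau\in[0,1/2]$ there is a strictly increasing sequence $(n_j)$ of natural numbers such that, for every $x\in\hat X$, $\lim_{j\to\infty}-\frac1{n_j^\beta}\log\mu(P_{n_j}(x))$ has the critical value $\tau$. Here, for a real number $c \ge 0$, a limit superior (respectively, limit) depending on a parameter $\beta>0$ has the critical value $c$ if it equals (respectively, exists and equals) $0$ for every $\beta>c$, and $\infty$ for every $\beta\in(0,c)$. -/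

import Mathlib

open Filter Topology MeasureTheory

/-- The set of (one-based) positions whose blocks may be permuted in a concatenation of `N` words:
`{2} ∪ {i² : 2 ≤ i ≤ √N}`. -/
def permutedPositions (N : ℕ) : Set ℕ :=
  {2} ∪ {m | ∃ i : ℕ, 2 ≤ i ∧ i ^ 2 ≤ N ∧ m = i ^ 2}

/-- `v` arises from the ordered list of words `L = [u₁, …, u_N]` by concatenating the words in the
order `u_{π(1)} u_{π(2)} ⋯ u_{π(N)}`, where the permutation `π` fixes every index whose
one-based position is not in `permutedPositions N`. -/
def IsPermutedConcat (L : List (List Bool)) (v : List Bool) : Prop :=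
  ∃ π : Equiv.Perm (Fin L.length),
    (∀ i : Fin L.length, (i : ℕ) + 1 ∉ permutedPositions L.length → π i = i) ∧
    v = (List.ofFn fun i => L.get (π i)).flatten

/-- `C` is a sequence of ordered word sets obtained by the marker construction with initial word
length `l₁`. The list `C j` enumerates, without repetition, the words of level `j + 1` in their
chosen order; the symbols `0`, `1` are `false`, `true`. The order of the words at each level is
arbitrary, except that after the first level the plain concatenation comes first. -/
structure IsMarkerConstruction (l₁ : ℕ) (C : ℕ → List (List Bool)) : Prop where
  /-- The words of a level are listed without repetition. -/
  nodup : ∀ j, (C j).Nodup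
  /-- There are `2 ^ √l₁` words on the first level. -/
  first_card : (C 0).length = 2 ^ Nat.sqrt l₁
  /-- The words on the first level have length `l₁`. -/
  first_length : ∀ v ∈ C 0, v.length = l₁
  /-- The words on the first level start with `001`. -/
  first_marker : ∀ v ∈ C 0, [false, false, true] <+: v
  /-- In a word on the first level, `00` occurs only as a prefix. -/
  first_no_zeros : ∀ v ∈ C 0, ¬ [false, false] <:+: v.tail
  /-- The words on the next level are exactly the permuted concatenations. -/
  mem_succ : ∀ j v, v ∈ C (j + 1) ↔ IsPermutedConcat (C j) v
  /-- The first word on the next level is the concatenation in the given order. -/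
  head_succ : ∀ j, (C (j + 1)).head? = some (C j).flatten

/-- The bi-infinite binary sequences all of whose finite words are subwords (contiguous blocks) of
words in the lists `C j`. -/
def generatedSubshift (C : ℕ → List (List Bool)) : Set (ℤ → Bool) :=
  {x | ∀ (a : ℤ) (n : ℕ), ∃ j, ∃ v ∈ C j, (List.ofFn fun i : Fin n => x (a + (i : ℕ))) <:+: v}

/-- The left shift on bi-infinite binary sequences. -/
def leftShift (x : ℤ → Bool) : ℤ → Bool := fun i => x (i + 1)

/-- `μ` is a shift-invariant Borel probability measure carried by `X`. -/
structure IsInvariantProbabilityOn (X : Set (ℤ → Bool)) (μ : Measure (ℤ → Bool)) : Prop where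
  isProbabilityMeasure : IsProbabilityMeasure μ
  measurePreserving : MeasurePreserving leftShift μ μ
  compl_null : μ Xᶜ = 0

/-- The `n`-cylinder `P_n(x) = {y ∈ X : y_i = x_i for 0 ≤ i < n}`. -/
def cylinderAt (X : Set (ℤ → Bool)) (n : ℕ) (x : ℤ → Bool) : Set (ℤ → Bool) :=
  {y | y ∈ X ∧ ∀ i : ℕ, i < n → y i = x i}

/-- The quantity `- log μ(P_n(x)) / n ^ β`, as an extended real (so that `- log 0 = ∞`). -/
noncomputable def atomRate (X : Set (ℤ → Bool)) (μ : Measure (ℤ → Bool)) (x : ℤ → Bool)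
    (β : ℝ) (n : ℕ) : EReal :=
  -ENNReal.log (μ (cylinderAt X n x)) / (((n : ℝ) ^ β : ℝ) : EReal)

/-- For `β > 0`, the upper limit of `f β n` as `n → ∞` is `0` when `β > c` and `∞` when
`β < c`. -/
def LimsupHasCriticalValue (f : ℝ → ℕ → EReal) (c : ℝ) : Prop :=
  ∀ β : ℝ, 0 < β →
    (c < β → limsup (f β) atTop = 0) ∧ (β < c → limsup (f β) atTop = ⊤)

/-- For `β > 0`, the limit of `f β j` as `j → ∞` exists and is `0` when `β > c`, and exists and
is `∞` when `β < c`. -/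
def LimHasCriticalValue (f : ℝ → ℕ → EReal) (c : ℝ) : Prop :=
  ∀ β : ℝ, 0 < β →
    (c < β → Tendsto (f β) atTop (𝓝 0)) ∧ (β < c → Tendsto (f β) atTop (𝓝 ⊤))

/-! Write N_j for the number of words in `C j` and H_j for their common length. Exactly ⌊√N_j⌋
positions may be permuted, so H_{j+1} = N_j H_j and N_{j+1} = ⌊√N_j⌋!. In particular H_j is smaller
than any fixed positive power of N_j for large j (`eventually_wordLength_le_rpow`).

Recognizability (`isStart_iff_dvd`): the marker 001 locates the words of the first level. The first
position is never permuted, so every word of the next level begins with the same word and its start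
can be read off. Hence each point of the subshift is cut at every level in exactly one way.
Invariance makes the offset of the origin in its level-j word uniform. Since each word of level j
occurs exactly once in each word of level j + 1, every word of level j is shown at a given position
with measure 1/H_{j+1} (`measure_block_eq`). This determines the invariant measure
(`invariant_unique`). It exists as a weak limit of orbit averages (`exists_invariant`).

Cylinders: suppose that the window [0, n) lies in the level-(k+1) word that starts at -r. Fixing the
symbols in the window amounts, up to boundary blocks, to fixing the words at the T permuted
positions that the window covers, so μ(P_n(x)) is about (p - T)! / (p! H_{k+1}) with p = ⌊√N_k⌋. The
permuted positions are squares (and 2), so T is about √((r+n)/H_k) - √(r/H_k) (`info_le`,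
`le_info`).

By Borel–Cantelli, almost every x has, at every large level, its origin at distance at least about
H_j/(j+2)^2 from both ends of its word (`ae_eventually_isGeneric`). For such x:

Upper bound (`eventually_info_le`): T is at most of order √(n/H_k), and each position costs at most
log N_k ≤ √H_k log H_k. The information is therefore O(√n log² n).

Prescribed exponents (`limHasCriticalValue_blockCount`): take n = q H_k with q equal to N_k^θ up to
a factor polynomial in k, where 1/2 ≤ θ ≤ 1. As r/H_k is comparable with N_k up to such factors, the
squares near r/H_k have gaps of order √N_k, so T is about N_k^{θ-1/2}, while n is N_k^{θ+o(1)}. The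
exponent is (θ - 1/2)/θ, which runs over [0, 1/2]. The case θ = 1 also shows that the limit superior
in the first claim is not smaller. -/

/-! ### Blocks of bi-infinite sequences -/

/-- The word of length `n` that `x` shows from position `a` on. -/
def block (x : ℤ → Bool) (a : ℤ) (n : ℕ) : List Bool := List.ofFn fun i : Fin n => x (a + (i : ℕ))

@[simp] lemma length_block (x : ℤ → Bool) (a : ℤ) (n : ℕ) : (block x a n).length = n := by
  simp [block]

lemma block_eq_block_iff {x y : ℤ → Bool} {a b : ℤ} {n : ℕ} :
    block x a n = block y b n ↔ ∀ i < n, x (a + (i : ℕ)) = y (b + (i : ℕ)) := by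
  unfold block
  rw [List.ofFn_inj, funext_iff]
  exact ⟨fun h i hi => h ⟨i, hi⟩, fun h i => h i i.2⟩

lemma block_congr_of_le {x y : ℤ → Bool} {a b : ℤ} {n : ℕ} (h : block x a n = block y b n)
    {t m : ℕ} (htm : t + m ≤ n) : block x (a + t) m = block y (b + t) m := by
  rw [block_eq_block_iff] at h ⊢
  intro i hi
  have := h (t + i) (by omega)
  push_cast at this
  rw [add_assoc, add_assoc]
  exact this

lemma block_mul (x : ℤ → Bool) (a : ℤ) (n h : ℕ) :
    block x a (n * h) = (List.ofFn fun i : Fin n => block x (a + (i : ℕ) * h) h).flatten := by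
  unfold block
  rw [List.ofFn_mul]
  simp [add_assoc]

lemma block_mul_eq_flatten_iff {x : ℤ → Bool} {a : ℤ} {n h : ℕ} {f : Fin n → List Bool}
    (hf : ∀ i, (f i).length = h) :
    block x a (n * h) = (List.ofFn f).flatten ↔ ∀ i : Fin n, block x (a + (i : ℕ) * h) h = f i := by
  rw [block_mul]
  constructor
  · intro H
    have := (List.eq_iff_flatten_eq (L := List.ofFn fun i : Fin n => block x (a + (i : ℕ) * h) h)
      (L' := List.ofFn f)).2 ⟨H, by
        rw [List.map_ofFn, List.map_ofFn]
        congr 1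
        funext i
        simp [hf]⟩
    rw [List.ofFn_inj] at this
    exact fun i => congrFun this i
  · intro H
    congr 2
    funext i
    exact H i

/-- A bi-infinite sequence that shows the word `v` at the origin. -/
def wordExtension (v : List Bool) : ℤ → Bool := fun i => v.getD i.toNat false

lemma block_wordExtension (v : List Bool) {t n : ℕ} (h : t + n ≤ v.length) :
    block (wordExtension v) t n = (v.drop t).take n := by
  apply List.ext_getElem
  · simp; omega
  · intro i h1 h2
    simp only [length_block] at h1
    have : ((t : ℤ) + (i : ℤ)).toNat = t + i := by omega
    simp [block, wordExtension, this, List.getD_eq_getElem?_getD]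
    rw [List.getElem?_eq_getElem (by omega)]
    simp

lemma block_wordExtension_self (v : List Bool) :
    block (wordExtension v) 0 v.length = v := by
  have := block_wordExtension v (t := 0) (n := v.length) (by simp)
  simpa using this

/-! ### Words of each level and recognizability -/

/-- The common length of the words in `C j`. -/
def wordLength (l₁ : ℕ) (C : ℕ → List (List Bool)) : ℕ → ℕ
  | 0 => l₁
  | j + 1 => (C j).length * wordLength l₁ C j

/-- The sequence `x` shows a word of level `j` at the position `a`. -/
def IsStart (l₁ : ℕ) (C : ℕ → List (List Bool)) (j : ℕ) (x : ℤ → Bool) (a : ℤ) : Prop :=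
  block x a (wordLength l₁ C j) ∈ C j

/-- The indices (counted from zero) of the blocks that may be permuted. -/
noncomputable def movable (N : ℕ) : Finset (Fin N) :=
  open Classical in Finset.univ.filter fun i => (i : ℕ) + 1 ∈ permutedPositions N

lemma mem_movable {N : ℕ} {i : Fin N} : i ∈ movable N ↔ (i : ℕ) + 1 ∈ permutedPositions N := by
  simp [movable]

/-- This is what makes recognizability pass from one level to the next: all words of a level begin
with the same word of the level below. -/
lemma zero_notMem_movable {N : ℕ} (h : 0 < N) : (⟨0, h⟩ : Fin N) ∉ movable N := by
  rw [mem_movable]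
  rintro (h | ⟨i, hi, -, h⟩)
  · simp at h
  · simp at h
    nlinarith

namespace IsMarkerConstruction

variable {l₁ : ℕ} {C : ℕ → List (List Bool)}

lemma length_eq (hC : IsMarkerConstruction l₁ C) :
    ∀ j, ∀ v ∈ C j, v.length = wordLength l₁ C j := by
  intro j
  induction j with
  | zero => exact hC.first_length
  | succ j ih =>
    intro v hv
    obtain ⟨π, -, rfl⟩ := (hC.mem_succ j v).1 hv
    rw [List.length_flatten, List.map_ofFn]
    have : (List.length ∘ fun i => (C j).get (π i)) = fun _ => wordLength l₁ C j := by
      funext i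
      exact ih _ (List.get_mem _ _)
    rw [this]
    simp [wordLength]

lemma length_pos (hC : IsMarkerConstruction l₁ C) : ∀ j, 0 < (C j).length
  | 0 => by rw [hC.first_card]; positivity
  | j + 1 => by
    have := hC.head_succ j
    rw [List.length_pos_iff]
    rintro h
    simp [h] at this

lemma three_le (hC : IsMarkerConstruction l₁ C) : 3 ≤ l₁ := by
  have h := List.getElem_mem (hC.length_pos 0)
  rw [← hC.first_length _ h]
  simpa using (hC.first_marker _ h).length_le

lemma wordLength_pos (hC : IsMarkerConstruction l₁ C) : ∀ j, 0 < wordLength l₁ C j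
  | 0 => by have := hC.three_le; simp only [wordLength]; omega
  | j + 1 => Nat.mul_pos (hC.length_pos j) (hC.wordLength_pos j)

lemma wordLength_dvd (i : ℕ) {j : ℕ} (hij : i ≤ j) : wordLength l₁ C i ∣ wordLength l₁ C j := by
  induction hij with
  | refl => rfl
  | step _ ih => exact Dvd.dvd.mul_left ih _

lemma wordLength_mono (hC : IsMarkerConstruction l₁ C) : Monotone (wordLength l₁ C) :=
  fun i _ hij => Nat.le_of_dvd (hC.wordLength_pos _) (wordLength_dvd i hij)

lemma isPermutedConcat_block_iff (hC : IsMarkerConstruction l₁ C) {j : ℕ} {x : ℤ → Bool} {a : ℤ}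
    {π : Equiv.Perm (Fin (C j).length)} :
    block x a (wordLength l₁ C (j + 1)) = (List.ofFn fun i => (C j).get (π i)).flatten ↔
      ∀ k : Fin (C j).length, block x (a + (k : ℕ) * wordLength l₁ C j) (wordLength l₁ C j) = (C j).get (π k) :=
  block_mul_eq_flatten_iff fun _ => hC.length_eq _ _ (List.get_mem _ _)

lemma isStart_succ_iff (hC : IsMarkerConstruction l₁ C) {j : ℕ} {x : ℤ → Bool} {a : ℤ} :
    IsStart l₁ C (j + 1) x a ↔ ∃ π : Equiv.Perm (Fin (C j).length),
      (∀ i, i ∉ movable (C j).length → π i = i) ∧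
      ∀ k : Fin (C j).length, block x (a + (k : ℕ) * wordLength l₁ C j) (wordLength l₁ C j) = (C j).get (π k) := by
  unfold IsStart
  rw [hC.mem_succ]
  simp only [IsPermutedConcat, hC.isPermutedConcat_block_iff, mem_movable]

lemma IsStart.sub (hC : IsMarkerConstruction l₁ C) {j : ℕ} {x : ℤ → Bool} {a : ℤ}
    (h : IsStart l₁ C (j + 1) x a) {k : ℕ} (hk : k < (C j).length) :
    IsStart l₁ C j x (a + k * wordLength l₁ C j) := by
  obtain ⟨π, -, hπ⟩ := hC.isStart_succ_iff.1 h
  unfold IsStart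
  have := hπ ⟨k, hk⟩
  simp only at this
  rw [this]
  exact List.get_mem _ _

lemma isStart_add_of_dvd (hC : IsMarkerConstruction l₁ C) {i J : ℕ} (hij : i ≤ J) {x : ℤ → Bool}
    {a : ℤ} (h : IsStart l₁ C J x a) {t : ℕ}
    (ht : t + wordLength l₁ C i ≤ wordLength l₁ C J) (hd : wordLength l₁ C i ∣ t) :
    IsStart l₁ C i x (a + t) := by
  induction J, hij using Nat.le_induction generalizing a t with
  | base =>
    have : t = 0 := by omega
    subst this
    simpa using h
  | succ J hij ih =>
    have hpos := hC.wordLength_pos i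
    have hposJ := hC.wordLength_pos J
    have htlt : t < (C J).length * wordLength l₁ C J := by
      simp only [wordLength] at ht; omega
    have hq : t / wordLength l₁ C J < (C J).length := Nat.div_lt_of_lt_mul (by rwa [mul_comm])
    have hs := IsStart.sub hC h hq
    have hdr : wordLength l₁ C i ∣ t % wordLength l₁ C J :=
      (Nat.dvd_mod_iff (wordLength_dvd i hij)).2 hd
    have hr : t % wordLength l₁ C J + wordLength l₁ C i ≤ wordLength l₁ C J := by
      obtain ⟨m, hm⟩ := hdr
      obtain ⟨n, hn⟩ := wordLength_dvd (l₁ := l₁) (C := C) i hij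
      have hlt := Nat.mod_lt t hposJ
      rw [hm] at hlt ⊢
      rw [hn] at hlt ⊢
      have : m < n := lt_of_mul_lt_mul_left hlt (Nat.zero_le _)
      nlinarith
    have := ih hs hr hdr
    have e : a + ↑(t / wordLength l₁ C J) * ↑(wordLength l₁ C J) +
        ((t % wordLength l₁ C J : ℕ) : ℤ) = a + t := by
      have := Nat.div_add_mod' t (wordLength l₁ C J)
      zify at this
      push_cast
      linarith
    rwa [e] at this

lemma marker_of_isStart (hC : IsMarkerConstruction l₁ C) {x : ℤ → Bool} {a : ℤ}
    (h : IsStart l₁ C 0 x a) : x a = false ∧ x (a + 1) = false ∧ x (a + 2) = true := by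
  obtain ⟨w, hw⟩ := hC.first_marker _ h
  have key : ∀ i (hi : i < l₁), (block x a l₁)[i]? = some (x (a + i)) := by
    intro i hi
    simp [block, hi]
  have h3 := hC.three_le
  have e : block x a (wordLength l₁ C 0) = block x a l₁ := rfl
  rw [e] at hw
  refine ⟨?_, ?_, ?_⟩
  · have := key 0 (by omega)
    rw [← hw] at this
    simpa using this.symm
  · have := key 1 (by omega)
    rw [← hw] at this
    simpa using this.symm
  · have := key 2 (by omega)
    rw [← hw] at this
    simpa using this.symm

lemma no_zeros_of_isStart (hC : IsMarkerConstruction l₁ C) {x : ℤ → Bool} {a : ℤ}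
    (h : IsStart l₁ C 0 x a) {r : ℕ} (hr : 0 < r) (hr' : r + 1 < l₁)
    (h0 : x (a + r) = false) (h1 : x (a + r + 1) = false) : False := by
  have h' : block x a l₁ ∈ C 0 := h
  apply hC.first_no_zeros _ h'
  have e : (((block x a l₁).tail.drop (r - 1)).take 2) = [false, false] := by
    apply List.ext_getElem
    · simp; omega
    · intro i hi hi'
      simp at hi'
      have hi2 : i = 0 ∨ i = 1 := by omega
      rcases hi2 with rfl | rfl
      · simp [block]
        rw [show ((r - 1 : ℕ) : ℤ) + 1 = r by omega]
        exact h0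
      · simp [block]
        rw [show a + (((r - 1 : ℕ) : ℤ) + 1 + 1) = a + r + 1 by omega]
        exact h1
  rw [← e]
  exact (List.take_prefix _ _).isInfix.trans (List.drop_suffix _ _).isInfix

/-- Recognizability inside a word: lower level words occur only at the obvious positions. -/
lemma dvd_of_isStart (hC : IsMarkerConstruction l₁ C) {i J : ℕ} (hij : i ≤ J) {x : ℤ → Bool}
    {a : ℤ} (h : IsStart l₁ C J x a) {t : ℕ}
    (ht : t + wordLength l₁ C i ≤ wordLength l₁ C J) (hs : IsStart l₁ C i x (a + t)) :
    wordLength l₁ C i ∣ t := by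
  induction i generalizing t with
  | zero =>
    by_contra hd
    have h3 := hC.three_le
    set r := t % l₁ with hr
    have hr0 : 0 < r := Nat.pos_of_ne_zero fun h0 => hd (Nat.dvd_of_mod_eq_zero h0)
    have hrl : r < l₁ := Nat.mod_lt _ (by omega)
    have hdm := Nat.div_add_mod t l₁
    obtain ⟨n, hn⟩ := wordLength_dvd (l₁ := l₁) (C := C) 0 hij
    simp only [wordLength] at hn ht
    -- The occurrence overruns its first-level word, so a next word exists inside the large word;
    -- its marker is used below.
    have hq1 : t / l₁ + 1 < n := by
      rw [hn, ← hdm] at ht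
      by_contra hcon
      have : l₁ * n ≤ l₁ * (t / l₁ + 1) := Nat.mul_le_mul_left _ (by omega)
      nlinarith
    have hle : l₁ * (t / l₁ + 1) + l₁ ≤ l₁ * n := by
      have : l₁ * (t / l₁ + 1 + 1) ≤ l₁ * n := Nat.mul_le_mul_left _ (by omega)
      nlinarith
    have hA : IsStart l₁ C 0 x (a + (l₁ * (t / l₁) : ℕ)) :=
      hC.isStart_add_of_dvd hij h (by simp only [wordLength]; rw [hn]; nlinarith)
        (Dvd.intro _ rfl)
    have hB : IsStart l₁ C 0 x (a + (l₁ * (t / l₁ + 1) : ℕ)) :=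
      hC.isStart_add_of_dvd hij h (by simp only [wordLength]; rw [hn]; exact hle)
        (Dvd.intro _ rfl)
    obtain ⟨m0, m1, m2⟩ := hC.marker_of_isStart hs
    obtain ⟨b0, b1, b2⟩ := hC.marker_of_isStart hB
    have hta : a + (t : ℤ) = a + (l₁ * (t / l₁) : ℕ) + r := by
      zify at hdm; push_cast; rw [hr]; push_cast; linarith
    -- Either the shifted 00 lies within a single first-level word, away from its prefix, or it
    -- starts at the last symbol of one. In the latter case the 1 of the shifted marker meets the
    -- second 0 of the next word.
    by_cases hlast : r + 1 < l₁
    · refine hC.no_zeros_of_isStart hA hr0 hlast ?_ ?_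
      · rw [← hta]; exact m0
      · rw [← hta]; exact m1
    · have : a + (t : ℤ) + 2 = a + (l₁ * (t / l₁ + 1) : ℕ) + 1 := by
        rw [hta]
        have : (r : ℤ) + 1 = l₁ := by omega
        push_cast
        linear_combination this
      rw [this, b1] at m2
      simp at m2
  | succ i ih =>
    have hN := hC.length_pos i
    have hi := hC.wordLength_pos i
    have hi' := hC.wordLength_pos (i + 1)
    have hs0 := IsStart.sub hC hs hN
    have hle : wordLength l₁ C i ≤ wordLength l₁ C (i + 1) := hC.wordLength_mono (Nat.le_succ i)
    have hd : wordLength l₁ C i ∣ t := ih (by omega) (by omega) (by simpa using hs0)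
    set H := wordLength l₁ C (i + 1) with hH
    obtain ⟨n, hn⟩ := wordLength_dvd (l₁ := l₁) (C := C) (i + 1) hij
    rw [← hH] at hn
    have hdm := Nat.div_add_mod t H
    have hq : t / H < n := by
      by_contra hcon
      have : H * n ≤ H * (t / H) := Nat.mul_le_mul_left _ (by omega)
      omega
    have hA : IsStart l₁ C (i + 1) x (a + (H * (t / H) : ℕ)) :=
      hC.isStart_add_of_dvd hij h (by
        rw [← hH, hn]
        have : H * (t / H + 1) ≤ H * n := Nat.mul_le_mul_left _ hq
        nlinarith) (Dvd.intro _ rfl)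
    have hdr : wordLength l₁ C i ∣ t % H :=
      (Nat.dvd_mod_iff (wordLength_dvd i (Nat.le_succ i))).2 hd
    obtain ⟨k, hk⟩ := hdr
    have hkN : k < (C i).length := by
      have : t % H < H := Nat.mod_lt _ hi'
      rw [hk, hH] at this
      simp only [wordLength] at this
      rw [mul_comm (C i).length] at this
      exact lt_of_mul_lt_mul_left this (Nat.zero_le _)
    obtain ⟨π, hπ, hb⟩ := hC.isStart_succ_iff.1 hA
    obtain ⟨π', hπ', hb'⟩ := hC.isStart_succ_iff.1 hs
    have e1 := hb ⟨k, hkN⟩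
    -- The alleged word begins with the first word of level `i`. In the true word of level `i + 1`
    -- that word occupies only position 0, so the block index `k` must vanish.
    have e2 := hb' ⟨0, hN⟩
    rw [hπ' _ (zero_notMem_movable hN)] at e2
    have epos : a + ((H * (t / H) : ℕ) : ℤ) + (k : ℕ) * (wordLength l₁ C i : ℤ) = a + t := by
      rw [hk] at hdm
      zify at hdm
      push_cast
      linarith
    simp only [epos] at e1
    simp only [Nat.cast_zero, zero_mul, add_zero] at e2
    rw [e1, (hC.nodup i).get_inj_iff] at e2
    have : π ⟨k, hkN⟩ = π ⟨0, hN⟩ := by rw [e2, hπ _ (zero_notMem_movable hN)]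
    have hk0 := π.injective this
    simp only [Fin.mk.injEq] at hk0
    rw [hk0, mul_zero] at hk
    exact Nat.dvd_of_mod_eq_zero hk

/-- Every window of a point of the subshift appears in a word of high level. -/
lemma exists_window (hC : IsMarkerConstruction l₁ C) {x : ℤ → Bool}
    (hx : x ∈ generatedSubshift C) (i : ℕ) (a : ℤ) (n : ℕ) :
    ∃ J, i ≤ J ∧ ∃ y : ℤ → Bool, IsStart l₁ C J y 0 ∧ ∃ o : ℕ, o + n ≤ wordLength l₁ C J ∧
      block x a n = block y o n := by
  -- Lengthening the window by one word of level `i` forces the surrounding word to have level at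
  -- least `i`, except when `n = 0`.
  obtain ⟨j, v, hv, s, t, hst⟩ := hx a (n + wordLength l₁ C i)
  have hlen := hC.length_eq j v hv
  have hst' : s ++ block x a (n + wordLength l₁ C i) ++ t = v := hst
  have hl2 : s.length + (n + wordLength l₁ C i) + t.length = wordLength l₁ C j := by
    rw [← hlen, ← hst']; simp [add_assoc]
  have hstart : IsStart l₁ C j (wordExtension v) 0 := by
    unfold IsStart
    rw [← hlen, block_wordExtension_self]
    exact hv
  have hblk : block x a (n + wordLength l₁ C i) =
      block (wordExtension v) s.length (n + wordLength l₁ C i) := by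
    rw [block_wordExtension v (by omega), ← hst']
    simp [length_block]
  by_cases hij : i ≤ j
  · refine ⟨j, hij, wordExtension v, hstart, s.length, by omega, ?_⟩
    have := block_congr_of_le hblk (t := 0) (m := n) (by omega)
    simpa using this
  · have h1 := hC.wordLength_mono (le_of_not_ge hij)
    have hn0 : n = 0 := by omega
    subst hn0
    obtain ⟨w, hw⟩ := List.exists_mem_of_length_pos (hC.length_pos i)
    refine ⟨i, le_rfl, wordExtension w, ?_, 0, by simp, ?_⟩
    · unfold IsStart
      rw [← hC.length_eq i w hw, block_wordExtension_self]
      exact hw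
    · simp [block]

lemma isStart_congr {i : ℕ} {x y : ℤ → Bool} {a b : ℤ}
    (h : block x a (wordLength l₁ C i) = block y b (wordLength l₁ C i)) :
    IsStart l₁ C i x a ↔ IsStart l₁ C i y b := by
  unfold IsStart
  rw [h]

lemma exists_isStart (hC : IsMarkerConstruction l₁ C) {x : ℤ → Bool}
    (hx : x ∈ generatedSubshift C) (i : ℕ) : ∃ a, IsStart l₁ C i x a := by
  have hpos := hC.wordLength_pos i
  obtain ⟨J, hJ, y, hy, o, ho, he⟩ := hC.exists_window hx i 0 (2 * wordLength l₁ C i)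
  set H := wordLength l₁ C i with hH
  have hdm := Nat.div_add_mod o H
  have hlt := Nat.mod_lt o hpos
  have hto : H * (o / H + 1) = o + (H - o % H) := by
    rw [mul_add, mul_one]
    omega
  have hs := hC.isStart_add_of_dvd hJ hy (t := H * (o / H + 1)) (by rw [← hH]; omega)
    (Dvd.intro _ rfl)
  rw [hto] at hs
  have := block_congr_of_le he (t := H - o % H) (m := H) (by omega)
  refine ⟨0 + ((H - o % H : ℕ) : ℤ), (isStart_congr this).2 ?_⟩
  rw [zero_add, Nat.cast_add] at hs
  exact hs

/-- Recognizability: in a point of the subshift, the words of a level start exactly along an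
arithmetic progression. -/
lemma isStart_iff_dvd (hC : IsMarkerConstruction l₁ C) {x : ℤ → Bool}
    (hx : x ∈ generatedSubshift C) {i : ℕ} {a : ℤ} (ha : IsStart l₁ C i x a) (b : ℤ) :
    IsStart l₁ C i x b ↔ (wordLength l₁ C i : ℤ) ∣ b - a := by
  obtain ⟨c, p, q, hp, hq⟩ : ∃ (c : ℤ) (p q : ℕ), a = c + p ∧ b = c + q :=
    ⟨min a b, (a - min a b).toNat, (b - min a b).toNat, by omega, by omega⟩
  obtain ⟨J, hJ, y, hy, o, ho, he⟩ := hC.exists_window hx i c (p + q + wordLength l₁ C i)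
  have ha' := (isStart_congr (l₁ := l₁) (C := C) (i := i)
    (block_congr_of_le he (t := p) (by omega))).1 (by rwa [← hp])
  have hbq := isStart_congr (l₁ := l₁) (C := C) (i := i)
    (block_congr_of_le he (t := q) (by omega))
  rw [← hq] at hbq
  rw [← Nat.cast_add, ← zero_add ((o + p : ℕ) : ℤ)] at ha'
  rw [← Nat.cast_add, ← zero_add ((o + q : ℕ) : ℤ)] at hbq
  have hdp := hC.dvd_of_isStart hJ hy (by omega) ha'
  rw [hbq]
  have hba : b - a = ((o + q : ℕ) : ℤ) - ((o + p : ℕ) : ℤ) := by push_cast; omega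
  rw [hba, dvd_sub_left (Int.natCast_dvd_natCast.2 hdp), Int.natCast_dvd_natCast]
  exact ⟨hC.dvd_of_isStart hJ hy (by omega), hC.isStart_add_of_dvd hJ hy (by omega)⟩

end IsMarkerConstruction

/-! ### Counting permuted concatenations; growth of the levels -/

/-- Left multiplication by `π₀` carries the permutations supported in `R` to those that agree with
`π₀` off `R`. -/
lemma card_perm_eq_off {α : Type*} [Fintype α] [DecidableEq α] (R : Finset α)
    (π₀ : Equiv.Perm α) :
    (Finset.univ.filter fun π : Equiv.Perm α => ∀ i, i ∉ R → π i = π₀ i).card =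
      R.card.factorial := by
  have e : {π : Equiv.Perm α // ∀ i, ¬ i ∈ R → π i = i} ≃
      {π : Equiv.Perm α // ∀ i, i ∉ R → π i = π₀ i} :=
    (Equiv.mulLeft π₀).subtypeEquiv fun π => by simp
  rw [← Fintype.card_subtype, ← Fintype.card_congr e,
    ← Fintype.card_congr (Equiv.Perm.subtypeEquivSubtypePerm (· ∈ R)), Fintype.card_perm,
    Fintype.card_coe]

/-- The concatenation of the words of `L` in the order given by `π`. -/
def permWord (L : List (List Bool)) (π : Equiv.Perm (Fin L.length)) : List Bool :=
  (List.ofFn fun i => L.get (π i)).flatten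

/-- The concatenations of the words of `L` whose order differs from `π₀` only at indices in `R`. -/
noncomputable def permWords (L : List (List Bool)) (R : Finset (Fin L.length))
    (π₀ : Equiv.Perm (Fin L.length)) : Finset (List Bool) :=
  (Finset.univ.filter fun π : Equiv.Perm (Fin L.length) => ∀ i, i ∉ R → π i = π₀ i).image
    (permWord L)

lemma mem_permWords {L : List (List Bool)} {R : Finset (Fin L.length)}
    {π₀ : Equiv.Perm (Fin L.length)} {v : List Bool} :
    v ∈ permWords L R π₀ ↔ ∃ π : Equiv.Perm (Fin L.length),
      (∀ i, i ∉ R → π i = π₀ i) ∧ permWord L π = v := by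
  simp [permWords]

lemma card_movable {N : ℕ} (hN : 2 ≤ N) : (movable N).card = Nat.sqrt N := by
  have h1 : 1 ≤ Nat.sqrt N := Nat.le_sqrt.2 (by omega)
  have key : (movable N).card = (Finset.range (Nat.sqrt N)).card := by
    symm
    -- The value 0 stands for position 2, and i ≥ 1 for position (i + 1)^2. The square 1 is missing
    -- from the permuted positions and 2 takes its place, so the count is exactly ⌊√N⌋.
    refine Finset.card_bij' (fun i _ => if h : i = 0 then (⟨1, by omega⟩ : Fin N) else
        if h' : (i + 1) ^ 2 - 1 < N then ⟨(i + 1) ^ 2 - 1, h'⟩ else ⟨1, by omega⟩)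
      (fun m _ => if (m : ℕ) = 1 then 0 else Nat.sqrt (m + 1) - 1) ?_ ?_ ?_ ?_
    · intro i hi
      rw [Finset.mem_range] at hi
      have hsq : (i + 1) ^ 2 ≤ N := by rw [pow_two]; exact Nat.le_sqrt.1 hi
      have hpos : 0 < (i + 1) ^ 2 := by positivity
      rw [mem_movable]
      by_cases h : i = 0
      · simp [h, permutedPositions]
      · rw [dif_neg h, dif_pos (by omega)]
        refine Or.inr ⟨i + 1, by omega, hsq, ?_⟩
        simp only
        omega
    · intro m hm
      rw [Finset.mem_range]
      by_cases h : (m : ℕ) = 1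
      · simp [h]; omega
      · rw [if_neg h]
        have : Nat.sqrt (m + 1) ≤ Nat.sqrt N := Nat.sqrt_le_sqrt (by omega)
        omega
    · intro i hi
      rw [Finset.mem_range] at hi
      have hsq : (i + 1) ^ 2 ≤ N := by rw [pow_two]; exact Nat.le_sqrt.1 hi
      have hpos : 0 < (i + 1) ^ 2 := by positivity
      by_cases h : i = 0
      · simp [h]
      · rw [dif_neg h, dif_pos (by omega)]
        have h4 : 4 ≤ (i + 1) ^ 2 := by nlinarith [show 1 ≤ i by omega]
        simp only
        rw [if_neg (by omega), Nat.sub_add_cancel (by omega), pow_two, Nat.sqrt_eq]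
        rfl
    · intro m hm
      rw [mem_movable] at hm
      rcases hm with hm | ⟨i, hi, hiN, hm⟩
      · have h1 : (m : ℕ) = 1 := by simpa using hm
        rw [if_pos h1, dif_pos rfl]
        exact Fin.ext h1.symm
      · have h4 : 4 ≤ i ^ 2 := by nlinarith
        have hm1 : (m : ℕ) ≠ 1 := by omega
        have hs : Nat.sqrt (m + 1) - 1 = i - 1 := by rw [hm, pow_two, Nat.sqrt_eq]
        apply Fin.ext
        simp only [hs, if_neg hm1]
        rw [dif_neg (by omega), dif_pos (by rw [Nat.sub_add_cancel (by omega)]; omega)]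
        simp only
        rw [Nat.sub_add_cancel (by omega)]
        omega
  rw [key, Finset.card_range]

lemma two_mul_succ_sq_le_factorial {p : ℕ} (hp : 5 ≤ p) : 2 * (p + 1) ^ 2 ≤ p.factorial := by
  induction p, hp using Nat.le_induction with
  | base => decide
  | succ p hp ih =>
    rw [Nat.factorial_succ]
    nlinarith [Nat.mul_le_mul_left (p + 1) ih, Nat.mul_le_mul_right ((p + 1) ^ 2) hp]

lemma succ_pow_ten_le_factorial_pow {p : ℕ} (hp : 5 ≤ p) :
    (p + 1) ^ 10 ≤ p.factorial ^ 4 := by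
  induction p, hp using Nat.le_induction with
  | base => decide
  | succ p hp ih =>
    rw [Nat.factorial_succ, mul_pow]
    calc (p + 1 + 1) ^ 10 ≤ (2 * (p + 1)) ^ 10 := Nat.pow_le_pow_left (by omega) _
      _ = 1024 * (p + 1) ^ 10 := by ring
      _ ≤ (p + 1) ^ 4 * (p + 1) ^ 10 := by
        apply Nat.mul_le_mul_right
        calc 1024 ≤ 6 ^ 4 := by norm_num
          _ ≤ (p + 1) ^ 4 := Nat.pow_le_pow_left (by omega) _
      _ ≤ (p + 1) ^ 4 * p.factorial ^ 4 := Nat.mul_le_mul_left _ ih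

lemma sq_le_two_pow {k : ℕ} (hk : 4 ≤ k) : k ^ 2 ≤ 2 ^ k := by
  induction k, hk using Nat.le_induction with
  | base => decide
  | succ k hk ih => rw [pow_succ 2]; nlinarith

namespace IsMarkerConstruction

variable {l₁ : ℕ} {C : ℕ → List (List Bool)}

lemma permWord_injective (hC : IsMarkerConstruction l₁ C) (j : ℕ) :
    Function.Injective (permWord (C j)) := by
  intro π π' h
  have hl : ∀ π : Equiv.Perm (Fin (C j).length), ∀ i, ((C j).get (π i)).length = wordLength l₁ C j :=
    fun π i => hC.length_eq _ _ (List.get_mem _ _)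
  have := (List.eq_iff_flatten_eq (L := List.ofFn fun i => (C j).get (π i))
    (L' := List.ofFn fun i => (C j).get (π' i))).2 ⟨h, by
      rw [List.map_ofFn, List.map_ofFn]
      congr 1
      funext i
      simp only [Function.comp, hl]⟩
  rw [List.ofFn_inj] at this
  ext i
  exact congrArg Fin.val (((hC.nodup j).get_inj_iff).1 (congrFun this i))

lemma card_permWords (hC : IsMarkerConstruction l₁ C) {j : ℕ} (R : Finset (Fin (C j).length))
    (π₀ : Equiv.Perm (Fin (C j).length)) :
    (permWords (C j) R π₀).card = R.card.factorial := by
  rw [permWords, Finset.card_image_of_injective _ (hC.permWord_injective j)]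
  convert card_perm_eq_off R π₀

lemma toFinset_succ (hC : IsMarkerConstruction l₁ C) (j : ℕ) :
    (C (j + 1)).toFinset = permWords (C j) (movable (C j).length) 1 := by
  ext v
  rw [List.mem_toFinset, hC.mem_succ, mem_permWords]
  simp only [IsPermutedConcat, permWord, mem_movable, Equiv.Perm.one_apply, eq_comm]

lemma length_succ_eq_card (hC : IsMarkerConstruction l₁ C) (j : ℕ) :
    (C (j + 1)).length = (movable (C j).length).card.factorial := by
  rw [← List.toFinset_card_of_nodup (hC.nodup _), hC.toFinset_succ, hC.card_permWords]

/-- With p = ⌊√N_j⌋ ≥ 5 one has p! ≥ 2(p+1)^2 > 2N_j, so the number of words at least doubles. The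
start 32 = 2^5 comes from √l₁ ≥ 5. -/
lemma le_length (hC : IsMarkerConstruction l₁ C) (hl₁ : 25 ≤ l₁) (j : ℕ) :
    32 * 2 ^ j ≤ (C j).length := by
  induction j with
  | zero =>
    rw [hC.first_card]
    have : 5 ≤ Nat.sqrt l₁ := Nat.le_sqrt.2 hl₁
    calc 32 * 2 ^ 0 = 2 ^ 5 := by norm_num
      _ ≤ _ := Nat.pow_le_pow_right (by norm_num) this
  | succ j ih =>
    have h1 : 1 ≤ 2 ^ j := Nat.one_le_two_pow
    rw [hC.length_succ_eq_card, card_movable (by omega)]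
    have hp : 5 ≤ Nat.sqrt (C j).length := Nat.le_sqrt.2 (by omega)
    have h2 := two_mul_succ_sq_le_factorial hp
    have h3 := Nat.lt_succ_sqrt (C j).length
    rw [pow_succ]
    nlinarith

lemma length_succ (hC : IsMarkerConstruction l₁ C) (hl₁ : 25 ≤ l₁) (j : ℕ) :
    (C (j + 1)).length = (Nat.sqrt (C j).length).factorial := by
  have := hC.le_length hl₁ j
  have h1 : 1 ≤ 2 ^ j := Nat.one_le_two_pow
  rw [hC.length_succ_eq_card, card_movable (by omega)]

lemma le_wordLength (hC : IsMarkerConstruction l₁ C) (hl₁ : 25 ≤ l₁) (j : ℕ) :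
    25 * 32 ^ j ≤ wordLength l₁ C j := by
  induction j with
  | zero => simpa [wordLength] using hl₁
  | succ j ih =>
    have h0 := hC.le_length hl₁ j
    have h1 : 1 ≤ 2 ^ j := Nat.one_le_two_pow
    simp only [wordLength]
    calc 25 * 32 ^ (j + 1) = 32 * (25 * 32 ^ j) := by ring
      _ ≤ _ := Nat.mul_le_mul (by omega) ih

/-- The induction closes because H_{j+1} ≤ N_j^5 ≤ (p+1)^10 ≤ (p!)^4 with p = ⌊√N_j⌋. On the first
level, l₁ = k^2 ≤ 2^k uses that l₁ is a perfect square. -/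
lemma wordLength_le_pow (hC : IsMarkerConstruction l₁ C) (hl₁ : 25 ≤ l₁) (hsq : IsSquare l₁)
    (j : ℕ) : wordLength l₁ C j ≤ (C j).length ^ 4 := by
  induction j with
  | zero =>
    rw [hC.first_card]
    obtain ⟨k, rfl⟩ := hsq
    have hk : 5 ≤ k := by nlinarith
    simp only [wordLength, Nat.sqrt_eq]
    calc k * k = k ^ 2 := by ring
      _ ≤ 2 ^ k := sq_le_two_pow (by omega)
      _ ≤ (2 ^ k) ^ 4 := Nat.le_self_pow (by norm_num) _
  | succ j ih =>
    have h0 := hC.le_length hl₁ j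
    have h1 : 1 ≤ 2 ^ j := Nat.one_le_two_pow
    have hp : 5 ≤ Nat.sqrt (C j).length := Nat.le_sqrt.2 (by omega)
    rw [hC.length_succ hl₁]
    simp only [wordLength]
    have h3 := Nat.lt_succ_sqrt (C j).length
    set p := Nat.sqrt (C j).length
    calc (C j).length * wordLength l₁ C j ≤ (C j).length * (C j).length ^ 4 :=
          Nat.mul_le_mul_left _ ih
      _ = (C j).length ^ 5 := by ring
      _ ≤ ((p + 1) ^ 2) ^ 5 := Nat.pow_le_pow_left (by rw [pow_two]; exact h3.le) _
      _ = (p + 1) ^ 10 := by ring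
      _ ≤ _ := succ_pow_ten_le_factorial_pow hp

end IsMarkerConstruction

/-! ### Shift, measurability and unique ergodicity -/

lemma iterate_leftShift_apply (r : ℕ) (x : ℤ → Bool) (i : ℤ) : leftShift^[r] x i = x (i + r) := by
  induction r generalizing i with
  | zero => simp
  | succ r ih =>
    rw [Function.iterate_succ_apply', leftShift, ih]
    congr 1
    push_cast
    ring

lemma block_iterate_leftShift (r : ℕ) (x : ℤ → Bool) (a : ℤ) (n : ℕ) :
    block (leftShift^[r] x) a n = block x (a + r) n := by
  rw [block_eq_block_iff]
  intro i _
  rw [iterate_leftShift_apply]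
  congr 1
  ring

lemma drop_take_block (x : ℤ → Bool) (a : ℤ) {t m n : ℕ} (h : t + m ≤ n) :
    ((block x a n).drop t).take m = block x (a + t) m := by
  apply List.ext_getElem
  · simp; omega
  · intro i hi hi'
    simp [block, add_assoc]

lemma measurable_window (a : ℤ) (n : ℕ) :
    Measurable fun (x : ℤ → Bool) (i : Fin n) => x (a + (i : ℕ)) :=
  measurable_pi_lambda _ fun _ => measurable_pi_apply _

lemma measurableSet_block (a : ℤ) (n : ℕ) (F : Set (List Bool)) :
    MeasurableSet {x : ℤ → Bool | block x a n ∈ F} :=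
  measurable_window a n (Set.toFinite {f : Fin n → Bool | List.ofFn f ∈ F}).measurableSet

lemma measurableSet_isStart (l₁ : ℕ) (C : ℕ → List (List Bool)) (j : ℕ) (a : ℤ) :
    MeasurableSet {x | IsStart l₁ C j x a} :=
  measurableSet_block a _ {v | v ∈ C j}

lemma measurableSet_generatedSubshift (C : ℕ → List (List Bool)) :
    MeasurableSet (generatedSubshift C) := by
  have : generatedSubshift C = ⋂ (a : ℤ) (n : ℕ), {x | block x a n ∈ {w | ∃ j, ∃ v ∈ C j, w <:+: v}} := by
    ext x
    simp [generatedSubshift, block]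
  rw [this]
  exact MeasurableSet.iInter fun a => MeasurableSet.iInter fun n => measurableSet_block _ _ _

/-- The partition is required only on the conull set `X`, because recognizability holds only for
points of the subshift. -/
lemma measure_eq_sum_of_partition {Ω ι : Type*} [MeasurableSpace Ω] {μ : Measure Ω} {X S : Set Ω}
    (hX : μ Xᶜ = 0) (hXm : MeasurableSet X) {s : Finset ι} {f : ι → Set Ω}
    (hf : ∀ i ∈ s, MeasurableSet (f i))
    (hdisj : ∀ x ∈ X, ∀ i ∈ s, ∀ j ∈ s, x ∈ f i → x ∈ f j → i = j)
    (hcov : ∀ x ∈ X, x ∈ S ↔ ∃ i ∈ s, x ∈ f i) : μ S = ∑ i ∈ s, μ (f i) := by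
  have hS : S ∩ X = ⋃ i ∈ s, f i ∩ X := by
    ext x
    simp only [Set.mem_inter_iff, Set.mem_iUnion, exists_prop]
    constructor
    · rintro ⟨h1, h2⟩
      obtain ⟨i, hi, h⟩ := (hcov x h2).1 h1
      exact ⟨i, hi, h, h2⟩
    · rintro ⟨i, hi, h, h2⟩
      exact ⟨(hcov x h2).2 ⟨i, hi, h⟩, h2⟩
  have hae : ∀ T : Set Ω, μ (T ∩ X) = μ T := fun T =>
    by rw [Set.inter_comm]; exact Measure.measure_inter_eq_of_ae (by rwa [ae_iff])
  rw [← hae S, hS, measure_biUnion_finset]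
  · exact Finset.sum_congr rfl fun i _ => hae _
  · intro i hi j hj hij
    refine Set.disjoint_left.2 fun x h1 h2 => hij (hdisj x h1.2 i hi j hj h1.1 h2.1)
  · exact fun i hi => (hf i hi).inter hXm

lemma IsInvariantProbabilityOn.measure_preimage_iterate {X : Set (ℤ → Bool)}
    {μ : Measure (ℤ → Bool)} (hμ : IsInvariantProbabilityOn X μ) (r : ℕ) {S : Set (ℤ → Bool)}
    (hS : MeasurableSet S) : μ (leftShift^[r] ⁻¹' S) = μ S :=
  (hμ.measurePreserving.iterate r).measure_preimage hS.nullMeasurableSet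

/-- Two probability measures agree as soon as they agree on the events that depend on a finite
window. -/
lemma ext_of_block {μ ν : Measure (ℤ → Bool)} [IsProbabilityMeasure μ] [IsProbabilityMeasure ν]
    (h : ∀ (n m : ℕ) (F : Set (List Bool)),
      μ {x | block x (-(n : ℤ)) m ∈ F} = ν {x | block x (-(n : ℤ)) m ∈ F}) : μ = ν := by
  refine ext_of_generate_finite (measurableCylinders fun _ : ℤ => Bool)
    generateFrom_measurableCylinders.symm isPiSystem_measurableCylinders ?_ (by simp)
  intro S hS
  obtain ⟨s, T, hT, rfl⟩ := (mem_measurableCylinders _).1 hS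
  obtain ⟨n, hn⟩ : ∃ n : ℕ, ∀ i ∈ s, i.natAbs < n :=
    ⟨s.sup Int.natAbs + 1, fun i hi => Nat.lt_succ_of_le (Finset.le_sup (f := Int.natAbs) hi)⟩
  -- The finite coordinate set lies in [-n, n), so the cylinder is a condition on one window of
  -- length 2n.
  have hcyl : cylinder s T = {x | block x (-(n : ℤ)) (2 * n) ∈
      {w | ∃ y ∈ cylinder s T, block y (-(n : ℤ)) (2 * n) = w}} := by
    ext x
    refine ⟨fun h => ⟨x, h, rfl⟩, ?_⟩
    rintro ⟨y, hy, hxy⟩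
    rw [mem_cylinder] at hy ⊢
    convert hy using 1
    funext ⟨i, hi⟩
    have hin := hn i hi
    have := block_eq_block_iff.1 hxy (i + n).toNat (by omega)
    rw [show -(n : ℤ) + ((i + n).toNat : ℤ) = i by omega] at this
    exact this.symm
  rw [hcyl]
  exact h _ _ _

namespace IsMarkerConstruction

variable {l₁ : ℕ} {C : ℕ → List (List Bool)} {μ : Measure (ℤ → Bool)}

lemma isStart_iterate {j : ℕ} {x : ℤ → Bool} {a : ℤ} (r : ℕ) :
    IsStart l₁ C j (leftShift^[r] x) a ↔ IsStart l₁ C j x (a + r) := by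
  unfold IsStart
  rw [block_iterate_leftShift]

lemma exists_offset (hC : IsMarkerConstruction l₁ C) {x : ℤ → Bool}
    (hx : x ∈ generatedSubshift C) (j : ℕ) :
    ∃ r < wordLength l₁ C j, IsStart l₁ C j x (-(r : ℤ)) := by
  obtain ⟨a, ha⟩ := hC.exists_isStart hx j
  have hpos : (0 : ℤ) < wordLength l₁ C j := by exact_mod_cast hC.wordLength_pos j
  have h1 := Int.emod_nonneg (-a) hpos.ne'
  have h2 := Int.emod_lt_of_pos (-a) hpos
  refine ⟨((-a) % (wordLength l₁ C j : ℤ)).toNat, by omega, ?_⟩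
  rw [hC.isStart_iff_dvd hx ha, Int.toNat_of_nonneg h1]
  have := Int.emod_add_mul_ediv (-a) (wordLength l₁ C j : ℤ)
  exact ⟨(-a) / (wordLength l₁ C j : ℤ), by linarith⟩

lemma offset_unique (hC : IsMarkerConstruction l₁ C) {x : ℤ → Bool}
    (hx : x ∈ generatedSubshift C) {j : ℕ} {r s : ℕ} (hr : r < wordLength l₁ C j)
    (hs : s < wordLength l₁ C j) (h1 : IsStart l₁ C j x (-(r : ℤ)))
    (h2 : IsStart l₁ C j x (-(s : ℤ))) : r = s := by
  have := (hC.isStart_iff_dvd hx h1 _).1 h2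
  have h3 : (r : ℤ) - s = 0 := by
    refine Int.eq_zero_of_abs_lt_dvd (m := wordLength l₁ C j) ?_ ?_
    · convert this using 1; ring
    · rw [abs_lt]; omega
  omega

lemma measure_eq_sum_offsets (hC : IsMarkerConstruction l₁ C)
    (hμ : IsInvariantProbabilityOn (generatedSubshift C) μ) (j : ℕ) {S : Set (ℤ → Bool)}
    (hS : MeasurableSet S) :
    μ S = ∑ r ∈ Finset.range (wordLength l₁ C j), μ (S ∩ {x | IsStart l₁ C j x (-(r : ℤ))}) := by
  refine measure_eq_sum_of_partition hμ.compl_null (measurableSet_generatedSubshift C) ?_ ?_ ?_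
  · exact fun r _ => hS.inter (measurableSet_isStart _ _ _ _)
  · intro x hx r hr s hs h1 h2
    exact hC.offset_unique hx (Finset.mem_range.1 hr) (Finset.mem_range.1 hs) h1.2 h2.2
  · intro x hx
    obtain ⟨r, hr, h⟩ := hC.exists_offset hx j
    exact ⟨fun hxS => ⟨r, Finset.mem_range.2 hr, hxS, h⟩, fun ⟨_, _, h⟩ => h.1⟩

/-- By invariance all offsets are equally likely, and the H_j possible offsets partition the
subshift. -/
lemma measure_isStart (hC : IsMarkerConstruction l₁ C)
    (hμ : IsInvariantProbabilityOn (generatedSubshift C) μ) (j : ℕ) (r : ℕ) :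
    μ {x | IsStart l₁ C j x (-(r : ℤ))} = (wordLength l₁ C j : ENNReal)⁻¹ := by
  have key : ∀ r : ℕ, μ {x | IsStart l₁ C j x (-(r : ℤ))} = μ {x | IsStart l₁ C j x 0} := by
    intro r
    rw [← hμ.measure_preimage_iterate r (measurableSet_isStart l₁ C j (-(r : ℤ)))]
    simp [isStart_iterate]
  have h := hC.measure_eq_sum_offsets hμ j MeasurableSet.univ
  have := hμ.isProbabilityMeasure
  simp only [Set.univ_inter, measure_univ, key, Finset.sum_const, Finset.card_range,
    nsmul_eq_mul] at h
  rw [key]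
  exact ENNReal.eq_inv_of_mul_eq_one_left (by rw [mul_comm]; exact h.symm)

/-- Each word of level `j + 1` contains `w` exactly once. Splitting by the place `k` of `w` in its
surrounding word and shifting by `k * H` turns "`w` at the origin" into "a word of level `j + 1` at
the origin, with `w` at place `k`". Summing over `k` leaves the measure of a start, whatever `w` is.
-/
lemma measure_block_eq (hC : IsMarkerConstruction l₁ C)
    (hμ : IsInvariantProbabilityOn (generatedSubshift C) μ) (j : ℕ) {w : List Bool}
    (hw : w ∈ C j) (r : ℕ) :
    μ {x | block x (-(r : ℤ)) (wordLength l₁ C j) = w} =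
      (wordLength l₁ C (j + 1) : ENNReal)⁻¹ := by
  have hj := hC.wordLength_pos j
  have hm : ∀ a, MeasurableSet {x | block x a (wordLength l₁ C j) = w} :=
    fun a => measurableSet_block a _ {w}
  have hr0 : μ {x | block x (-(r : ℤ)) (wordLength l₁ C j) = w} =
      μ {x | block x 0 (wordLength l₁ C j) = w} := by
    rw [← hμ.measure_preimage_iterate r (hm _)]
    simp [block_iterate_leftShift]
  rw [hr0, ← hC.measure_isStart hμ (j + 1) 0]
  set H := wordLength l₁ C j with hH
  have e1 : μ {x | block x 0 H = w} = ∑ k ∈ Finset.range (C j).length,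
      μ {x | IsStart l₁ C (j + 1) x (-((k * H : ℕ) : ℤ)) ∧ block x 0 H = w} := by
    refine measure_eq_sum_of_partition hμ.compl_null (measurableSet_generatedSubshift C) ?_ ?_ ?_
    · exact fun k _ => (measurableSet_isStart _ _ _ _).inter (hm _)
    · intro x hx k hk k' hk' h1 h2
      rw [Finset.mem_range] at hk hk'
      have := hC.offset_unique hx (Nat.mul_lt_mul_of_pos_right hk hj)
        (Nat.mul_lt_mul_of_pos_right hk' hj) h1.1 h2.1
      exact Nat.eq_of_mul_eq_mul_right hj this
    · intro x hx
      refine ⟨fun h => ?_, fun ⟨_, _, h⟩ => h.2⟩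
      obtain ⟨s, hs, h'⟩ := hC.exists_offset hx (j + 1)
      have h0 : IsStart l₁ C j x 0 := by
        unfold IsStart
        rw [← hH, show block x 0 H = w from h]
        exact hw
      have h1 := IsStart.sub hC h' (hC.length_pos j)
      have h2 := (hC.isStart_iff_dvd hx h0 _).1 h1
      have h3 : H ∣ s := by
        rw [← Int.natCast_dvd_natCast]
        simpa using h2
      obtain ⟨k, rfl⟩ := h3
      refine ⟨k, ?_, by rwa [mul_comm k], h⟩
      rw [Finset.mem_range]
      rw [mul_comm] at hs
      exact lt_of_mul_lt_mul_right hs (Nat.zero_le _)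
  have e2 : μ {x | IsStart l₁ C (j + 1) x (-((0 : ℕ) : ℤ))} = ∑ k ∈ Finset.range (C j).length,
      μ {x | IsStart l₁ C (j + 1) x 0 ∧ block x (k * H : ℕ) H = w} := by
    refine measure_eq_sum_of_partition hμ.compl_null (measurableSet_generatedSubshift C) ?_ ?_ ?_
    · exact fun k _ => (measurableSet_isStart _ _ _ _).inter (hm _)
    · intro x hx k hk k' hk' h1 h2
      rw [Finset.mem_range] at hk hk'
      obtain ⟨π, -, hπ⟩ := hC.isStart_succ_iff.1 h1.1
      have a1 := hπ ⟨k, hk⟩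
      have a2 := hπ ⟨k', hk'⟩
      have b1 := h1.2
      have b2 := h2.2
      simp only [zero_add, ← hH] at a1 a2
      rw [Nat.cast_mul] at b1 b2
      have : (C j).get (π ⟨k, hk⟩) = (C j).get (π ⟨k', hk'⟩) := by
        rw [← a1, ← a2, b1, b2]
      have := π.injective ((hC.nodup j).get_inj_iff.1 this)
      simpa using this
    · intro x hx
      refine ⟨fun h => ?_, fun ⟨_, _, h⟩ => by simpa using h.1⟩
      have h : IsStart l₁ C (j + 1) x 0 := by simpa using h
      obtain ⟨π, -, hπ⟩ := hC.isStart_succ_iff.1 h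
      obtain ⟨i, hi⟩ := List.mem_iff_get.1 hw
      refine ⟨(π.symm i : ℕ), by simp, h, ?_⟩
      have := hπ (π.symm i)
      rw [Equiv.apply_symm_apply, hi, zero_add] at this
      rw [Nat.cast_mul]
      exact this
  rw [e1, e2]
  refine Finset.sum_congr rfl fun k _ => ?_
  refine (hμ.measure_preimage_iterate (k * H) ((measurableSet_isStart l₁ C (j + 1)
    (-((k * H : ℕ) : ℤ))).inter (hm 0))).symm.trans ?_
  congr 1
  ext x
  simp only [Set.mem_preimage, Set.mem_inter_iff, Set.mem_ofPred_eq, isStart_iterate,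
    block_iterate_leftShift, neg_add_cancel, zero_add]

lemma measure_block_mem (hC : IsMarkerConstruction l₁ C)
    (hμ : IsInvariantProbabilityOn (generatedSubshift C) μ) (j : ℕ) {F : Finset (List Bool)}
    (hF : ∀ w ∈ F, w ∈ C j) (r : ℕ) :
    μ {x | block x (-(r : ℤ)) (wordLength l₁ C j) ∈ F} =
      (F.card : ENNReal) * (wordLength l₁ C (j + 1) : ENNReal)⁻¹ := by
  have : {x | block x (-(r : ℤ)) (wordLength l₁ C j) ∈ F} =
      ⋃ w ∈ F, {x | block x (-(r : ℤ)) (wordLength l₁ C j) = w} := by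
    ext x; simp
  rw [this, measure_biUnion_finset, Finset.sum_congr rfl fun w hw =>
    hC.measure_block_eq hμ j (hF w hw) r, Finset.sum_const, nsmul_eq_mul]
  · intro w _ w' _ hww'
    exact Set.disjoint_left.2 fun x h1 h2 => hww' (h1.symm.trans h2)
  · exact fun w _ => measurableSet_block _ _ {w}

/-- If the window lies inside the level-`j` word around the origin, the event is a condition on that
word, whose distribution is the same for both measures. At most `m` offsets let the window cross the
end, and each has measure 1/H_j. -/
lemma measure_le_add (hC : IsMarkerConstruction l₁ C) {ν : Measure (ℤ → Bool)}
    (hμ : IsInvariantProbabilityOn (generatedSubshift C) μ)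
    (hν : IsInvariantProbabilityOn (generatedSubshift C) ν) (m : ℕ) (F : Set (List Bool)) (j : ℕ) :
    μ {x | block x 0 m ∈ F} ≤ ν {x | block x 0 m ∈ F} + m * (wordLength l₁ C j : ENNReal)⁻¹ := by
  classical
  have hm := measurableSet_block 0 m F
  set S := {x : ℤ → Bool | block x 0 m ∈ F} with hS
  set H := wordLength l₁ C j with hH
  have hb : ∀ r ∈ Finset.range H, μ (S ∩ {x | IsStart l₁ C j x (-(r : ℤ))}) ≤
      ν (S ∩ {x | IsStart l₁ C j x (-(r : ℤ))}) + if H < r + m then (H : ENNReal)⁻¹ else 0 := by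
    intro r _
    split_ifs with h
    · exact (measure_mono Set.inter_subset_right).trans
        ((hC.measure_isStart hμ j r).le.trans le_add_self)
    · have : S ∩ {x | IsStart l₁ C j x (-(r : ℤ))} =
          {x | block x (-(r : ℤ)) H ∈
            (C j).toFinset.filter fun v => (v.drop r).take m ∈ F} := by
        ext x
        simp only [hS, Set.mem_inter_iff, Set.mem_ofPred_eq, IsStart, Finset.mem_filter,
          List.mem_toFinset, drop_take_block x (-(r : ℤ)) (not_lt.1 h), neg_add_cancel]
        exact and_comm
      rw [this, add_zero, hC.measure_block_mem hμ, hC.measure_block_mem hν]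
      all_goals
        intro w hw
        exact List.mem_toFinset.1 (Finset.mem_filter.1 hw).1
  rw [hC.measure_eq_sum_offsets hμ j hm, hC.measure_eq_sum_offsets hν j hm]
  refine (Finset.sum_le_sum hb).trans ?_
  rw [Finset.sum_add_distrib]
  gcongr
  rw [← Finset.sum_filter, Finset.sum_const, nsmul_eq_mul]
  gcongr
  calc _ ≤ (Finset.Ico (H - m) H).card := by
        apply Finset.card_le_card
        intro r hr
        simp only [Finset.mem_filter, Finset.mem_range, Finset.mem_Ico] at hr ⊢
        omega
    _ ≤ m := by rw [Nat.card_Ico]; omega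

lemma tendsto_wordLength (hC : IsMarkerConstruction l₁ C) (hl₁ : 25 ≤ l₁) :
    Tendsto (wordLength l₁ C) atTop atTop := by
  refine tendsto_atTop_mono (fun j => ?_) tendsto_id
  have h1 := hC.le_wordLength hl₁ j
  have h2 : j < 32 ^ j := Nat.lt_pow_self (by norm_num)
  simp only [id]
  omega

lemma measure_block_le (hC : IsMarkerConstruction l₁ C) (hl₁ : 25 ≤ l₁) {ν : Measure (ℤ → Bool)}
    (hμ : IsInvariantProbabilityOn (generatedSubshift C) μ)
    (hν : IsInvariantProbabilityOn (generatedSubshift C) ν) (m : ℕ) (F : Set (List Bool)) :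
    μ {x | block x 0 m ∈ F} ≤ ν {x | block x 0 m ∈ F} := by
  have hlim : Tendsto (fun j => ν {x | block x 0 m ∈ F} +
      m * (wordLength l₁ C j : ENNReal)⁻¹) atTop (𝓝 (ν {x | block x 0 m ∈ F} + m * 0)) := by
    refine Tendsto.const_add _ (ENNReal.Tendsto.const_mul ?_ (Or.inr (ENNReal.natCast_ne_top m)))
    exact ENNReal.tendsto_inv_nat_nhds_zero.comp (hC.tendsto_wordLength hl₁)
  rw [mul_zero, add_zero] at hlim
  exact ge_of_tendsto' hlim fun j => hC.measure_le_add hμ hν m F j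

/-- Unique ergodicity of the subshift. -/
lemma invariant_unique (hC : IsMarkerConstruction l₁ C) (hl₁ : 25 ≤ l₁) {ν : Measure (ℤ → Bool)}
    (hμ : IsInvariantProbabilityOn (generatedSubshift C) μ)
    (hν : IsInvariantProbabilityOn (generatedSubshift C) ν) : ν = μ := by
  have := hμ.isProbabilityMeasure
  have := hν.isProbabilityMeasure
  refine ext_of_block fun n m F => ?_
  have key : ∀ {ρ : Measure (ℤ → Bool)}, IsInvariantProbabilityOn (generatedSubshift C) ρ →
      ρ {x | block x (-(n : ℤ)) m ∈ F} = ρ {x | block x 0 m ∈ F} := by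
    intro ρ hρ
    rw [← hρ.measure_preimage_iterate n (measurableSet_block _ _ _)]
    simp [block_iterate_leftShift]
  rw [key hμ, key hν]
  exact le_antisymm (hC.measure_block_le hl₁ hν hμ _ _) (hC.measure_block_le hl₁ hμ hν _ _)

end IsMarkerConstruction

/-! ### Existence of an invariant measure -/

lemma isClopen_block (a : ℤ) (n : ℕ) (F : Set (List Bool)) :
    IsClopen {x : ℤ → Bool | block x a n ∈ F} := by
  have hc : Continuous fun (x : ℤ → Bool) (i : Fin n) => x (a + (i : ℕ)) :=
    continuous_pi fun _ => continuous_apply _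
  exact (isClopen_discrete {f : Fin n → Bool | List.ofFn f ∈ F}).preimage hc

/-- The uniform distribution on the first `h` points of the orbit of `y`. -/
noncomputable def orbitMeasure (y : ℤ → Bool) (h : ℕ) : Measure (ℤ → Bool) :=
  (h : ENNReal)⁻¹ • ∑ i ∈ Finset.range h, Measure.dirac (leftShift^[i] y)

lemma orbitMeasure_apply (y : ℤ → Bool) (h : ℕ) {S : Set (ℤ → Bool)} (hS : MeasurableSet S) :
    orbitMeasure y h S =
      (h : ENNReal)⁻¹ * ∑ i ∈ Finset.range h, S.indicator 1 (leftShift^[i] y) := by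
  simp [orbitMeasure, Measure.dirac_apply' _ hS]

lemma isProbabilityMeasure_orbitMeasure (y : ℤ → Bool) {h : ℕ} (hh : 0 < h) :
    IsProbabilityMeasure (orbitMeasure y h) := by
  constructor
  rw [orbitMeasure_apply _ _ MeasurableSet.univ]
  simp only [Set.indicator_univ, Pi.one_apply, Finset.sum_const, Finset.card_range, nsmul_eq_mul,
    mul_one]
  exact ENNReal.inv_mul_cancel (by exact_mod_cast hh.ne') (ENNReal.natCast_ne_top h)

lemma measurable_leftShift : Measurable leftShift :=
  measurable_pi_lambda _ fun _ => measurable_pi_apply _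

/-- The two orbit sums differ only in their end terms. An upper bound suffices, since invariance of
the limit follows by passing to complements. -/
lemma orbitMeasure_preimage_le (y : ℤ → Bool) (h : ℕ) {S : Set (ℤ → Bool)}
    (hS : MeasurableSet S) :
    orbitMeasure y h (leftShift ⁻¹' S) ≤ orbitMeasure y h S + (h : ENNReal)⁻¹ := by
  rw [orbitMeasure_apply _ _ hS, orbitMeasure_apply _ _ (measurable_leftShift hS)]
  nth_rewrite 3 [← mul_one (h : ENNReal)⁻¹]
  rw [← mul_add]
  gcongr
  have e : ∀ i, (leftShift ⁻¹' S).indicator (1 : (ℤ → Bool) → ENNReal) (leftShift^[i] y) =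
      S.indicator 1 (leftShift^[i + 1] y) := by
    intro i
    rw [Function.iterate_succ_apply']
    rfl
  simp only [e]
  calc _ ≤ ∑ i ∈ Finset.range (h + 1), S.indicator (1 : (ℤ → Bool) → ENNReal) (leftShift^[i] y) := by
        rw [Finset.sum_range_succ']
        exact le_self_add
    _ ≤ _ := by
        rw [Finset.sum_range_succ]
        gcongr
        exact Set.indicator_le_self' (by simp) _

lemma orbitMeasure_le_of_window (y : ℤ → Bool) (h m : ℕ) {S : Set (ℤ → Bool)}
    (hS : MeasurableSet S) (hm : ∀ i, m ≤ i → i + m ≤ h → leftShift^[i] y ∉ S) :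
    orbitMeasure y h S ≤ (2 * m : ℕ) * (h : ENNReal)⁻¹ := by
  rw [orbitMeasure_apply _ _ hS, mul_comm]
  gcongr
  calc _ ≤ ∑ i ∈ Finset.range h, if i ∈ Finset.range m ∪ Finset.Ioc (h - m) h then (1 : ENNReal)
          else 0 := by
        refine Finset.sum_le_sum fun i hi => ?_
        split_ifs with h'
        · exact Set.indicator_le_self' (by simp) _
        · rw [Set.indicator_of_notMem]
          simp only [Finset.mem_union, Finset.mem_range, Finset.mem_Ioc] at h' hi
          exact hm i (by omega) (by omega)
    _ ≤ _ := by
        rw [← Finset.sum_filter, Finset.sum_const, nsmul_eq_mul, mul_one]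
        gcongr
        calc _ ≤ (Finset.range m ∪ Finset.Ioc (h - m) h).card :=
              Finset.card_le_card fun i hi => (Finset.mem_filter.1 hi).2
          _ ≤ m + (h - (h - m)) := by
              refine (Finset.card_union_le _ _).trans ?_
              simp
          _ ≤ 2 * m := by omega

namespace IsMarkerConstruction

variable {l₁ : ℕ} {C : ℕ → List (List Bool)}

lemma exists_point (hC : IsMarkerConstruction l₁ C) (j : ℕ) :
    ∃ y : ℤ → Bool, ∀ t n : ℕ, t + n ≤ wordLength l₁ C j → ∃ v ∈ C j, block y t n <:+: v := by
  obtain ⟨w, hw⟩ := List.exists_mem_of_length_pos (hC.length_pos j)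
  refine ⟨wordExtension w, fun t n h => ⟨w, hw, ?_⟩⟩
  rw [block_wordExtension _ (by rwa [hC.length_eq j w hw])]
  exact (List.take_prefix _ _).isInfix.trans (List.drop_suffix _ _).isInfix

theorem exists_invariant (hC : IsMarkerConstruction l₁ C) (hl₁ : 25 ≤ l₁) :
    ∃ μ, IsInvariantProbabilityOn (generatedSubshift C) μ := by
  choose y hy using hC.exists_point
  let P : ℕ → ProbabilityMeasure (ℤ → Bool) := fun j =>
    ⟨orbitMeasure (y j) (wordLength l₁ C j), isProbabilityMeasure_orbitMeasure _ (hC.wordLength_pos j)⟩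
  -- An ultrafilter limit replaces the choice of a weakly convergent subsequence. Window events are
  -- clopen, so their measures converge.
  let U : Ultrafilter ℕ := hyperfilter ℕ
  have hU : (U : Filter ℕ) ≤ atTop := by
    rw [← Nat.cofinite_eq_atTop]; exact hyperfilter_le_cofinite
  obtain ⟨Q, -, hQ⟩ := isCompact_univ.ultrafilter_le_nhds (U.map P) (by simp)
  have hQ : Tendsto P U (𝓝 Q) := hQ
  have hlim : ∀ (a : ℤ) (n : ℕ) (F : Set (List Bool)), Tendsto (fun j => orbitMeasure (y j) (wordLength l₁ C j)
      {x | block x a n ∈ F}) U (𝓝 ((Q : Measure (ℤ → Bool)) {x | block x a n ∈ F})) := by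
    intro a n F
    have := ProbabilityMeasure.tendsto_measure_of_isClopen_of_tendsto hQ (isClopen_block a n F)
    have := ENNReal.tendsto_coe.2 this
    simp only [ProbabilityMeasure.ennreal_coeFn_eq_coeFn_toMeasure] at this
    exact this
  have hinv : Tendsto (fun j => (wordLength l₁ C j : ENNReal)⁻¹) U (𝓝 0) :=
    (ENNReal.tendsto_inv_nat_nhds_zero.comp (hC.tendsto_wordLength hl₁)).mono_left hU
  have hpre : ∀ (a : ℤ) (n : ℕ) (F : Set (List Bool)),
      leftShift ⁻¹' {x | block x a n ∈ F} = {x | block x (a + 1) n ∈ F} := by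
    intro a n F
    ext x
    have := block_iterate_leftShift 1 x a n
    simp only [Function.iterate_one, Nat.cast_one] at this
    simp [this]
  have hle : ∀ (a : ℤ) (n : ℕ) (F : Set (List Bool)),
      (Q : Measure (ℤ → Bool)) {x | block x (a + 1) n ∈ F} ≤
        (Q : Measure (ℤ → Bool)) {x | block x a n ∈ F} := by
    intro a n F
    have h1 := (hlim a n F).add hinv
    rw [add_zero] at h1
    refine le_of_tendsto_of_tendsto' (hlim (a + 1) n F) h1 fun j => ?_
    rw [← hpre]
    exact orbitMeasure_preimage_le _ _ (measurableSet_block _ _ _)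
  refine ⟨Q, inferInstance, ⟨measurable_leftShift, ?_⟩, ?_⟩
  · have : IsProbabilityMeasure (Measure.map leftShift (Q : Measure (ℤ → Bool))) :=
      Measure.isProbabilityMeasure_map measurable_leftShift.aemeasurable
    refine ext_of_block fun n m F => ?_
    rw [Measure.map_apply measurable_leftShift (measurableSet_block _ _ _), hpre]
    refine le_antisymm (hle _ _ _) ?_
    -- The inequality for the complementary event gives the reverse inequality.
    have h1 := hle (-(n : ℤ)) m Fᶜ
    have hcompl : ∀ a : ℤ, {x | block x a m ∈ Fᶜ} = {x | block x a m ∈ F}ᶜ := fun a => rfl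
    rw [hcompl, hcompl, prob_compl_eq_one_sub (measurableSet_block _ _ _),
      prob_compl_eq_one_sub (measurableSet_block _ _ _)] at h1
    exact (ENNReal.sub_le_sub_iff_left prob_le_one ENNReal.one_ne_top).1 h1
  · have hX : (generatedSubshift C)ᶜ = ⋃ (a : ℤ) (n : ℕ),
        {x | block x a n ∈ {w | ∃ j, ∃ v ∈ C j, w <:+: v}ᶜ} := by
      ext x
      simp [generatedSubshift, block]
    rw [hX]
    refine measure_iUnion_null fun a => measure_iUnion_null fun n => ?_
    -- Only orbit points within `a.natAbs + n` of either end of the word can show a forbidden block,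
    -- and their proportion tends to 0.
    have h2 : Tendsto (fun j => ((2 * (a.natAbs + n) : ℕ) : ENNReal) *
        (wordLength l₁ C j : ENNReal)⁻¹) U (𝓝 ((2 * (a.natAbs + n) : ℕ) * 0)) :=
      ENNReal.Tendsto.const_mul hinv (Or.inr (ENNReal.natCast_ne_top _))
    rw [mul_zero] at h2
    refine le_antisymm (le_of_tendsto_of_tendsto' (hlim a n _) h2 fun j => ?_) zero_le
    refine orbitMeasure_le_of_window _ _ _ (measurableSet_block _ _ _) fun i hi hi' hmem => ?_
    refine hmem ⟨j, ?_⟩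
    rw [block_iterate_leftShift]
    have := hy j (a + i).toNat n (by omega)
    rwa [show (((a + i).toNat : ℕ) : ℤ) = a + i by omega] at this

end IsMarkerConstruction

/-! ### Measures of cylinders -/

lemma mem_cylinderAt_iff {X : Set (ℤ → Bool)} {n : ℕ} {x y : ℤ → Bool} :
    y ∈ cylinderAt X n x ↔ y ∈ X ∧ block y 0 n = block x 0 n := by
  rw [block_eq_block_iff]
  simp [cylinderAt]

/-- The squares in [A, B] number at most √B - √A + 1, and position 2 adds one more. -/
lemma card_movable_le {N : ℕ} {T : Finset (Fin N)} (hT : T ⊆ movable N) {A B : ℝ}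
    (hAB : A ≤ B) (h : ∀ i ∈ T, A ≤ (i : ℕ) + 1 ∧ ((i : ℕ) : ℝ) + 1 ≤ B) :
    (T.card : ℝ) ≤ √B - √A + 2 := by
  classical
  have hroot : ∀ i ∈ T.filter fun i : Fin N => (i : ℕ) ≠ 1, ∃ q : ℕ, (i : ℕ) + 1 = q ^ 2 := by
    intro i hi
    rw [Finset.mem_filter] at hi
    rcases mem_movable.1 (hT hi.1) with h | ⟨q, -, -, h⟩
    · exact absurd (by simpa using h) hi.2
    · exact ⟨q, h⟩
  have h1 : (T.filter fun i : Fin N => (i : ℕ) ≠ 1).card ≤ (Finset.Icc ⌈√A⌉₊ ⌊√B⌋₊).card := by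
    refine Finset.card_le_card_of_injOn (fun i => Nat.sqrt (i + 1)) ?_ ?_
    · intro i hi
      obtain ⟨q, hq⟩ := hroot i hi
      obtain ⟨ha, hb⟩ := h i (Finset.mem_filter.1 hi).1
      have hq' : ((i : ℕ) : ℝ) + 1 = (q : ℝ) ^ 2 := by exact_mod_cast hq
      have hs : Nat.sqrt ((i : ℕ) + 1) = q := by rw [hq, pow_two, Nat.sqrt_eq]
      simp only [Finset.coe_Icc, Set.mem_Icc, hs]
      rw [hq'] at ha hb
      constructor
      · exact Nat.ceil_le.2 ((Real.sqrt_le_left (by positivity)).2 ha)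
      · exact Nat.le_floor (Real.le_sqrt_of_sq_le hb)
    · intro i hi j hj hij
      obtain ⟨q, hq⟩ := hroot i hi
      obtain ⟨q', hq'⟩ := hroot j hj
      simp only [hq, hq', pow_two, Nat.sqrt_eq] at hij
      rw [hij] at hq
      exact Fin.ext (by omega)
  have h2 : (T.filter fun i : Fin N => ¬ (i : ℕ) ≠ 1).card ≤ 1 := by
    rw [Finset.card_le_one]
    intro a ha b hb
    simp only [Finset.mem_filter, not_not] at ha hb
    exact Fin.ext (by omega)
  have h3 := Finset.card_filter_add_card_filter_not (s := T) fun i : Fin N => (i : ℕ) ≠ 1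
  have h4 : ((Finset.Icc ⌈√A⌉₊ ⌊√B⌋₊).card : ℝ) ≤ √B - √A + 1 := by
    rw [Nat.card_Icc]
    have hc := Nat.le_ceil √A
    have hf := Nat.floor_le (Real.sqrt_nonneg B)
    have hAB' := Real.sqrt_le_sqrt hAB
    rcases le_total ⌈√A⌉₊ (⌊√B⌋₊ + 1) with hle | hle
    · push_cast [Nat.cast_sub hle]
      linarith
    · rw [Nat.sub_eq_zero_of_le hle]
      push_cast
      linarith
  have h5 : T.card ≤ (Finset.Icc ⌈√A⌉₊ ⌊√B⌋₊).card + 1 := by omega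
  have h6 : (T.card : ℝ) ≤ (Finset.Icc ⌈√A⌉₊ ⌊√B⌋₊).card + 1 := by exact_mod_cast h5
  linarith

/-- Rounding both square roots costs at most one square, and the square 1, which is not a permuted
position, costs another. -/
lemma le_card_movable {N : ℕ} {T : Finset (Fin N)} {A B : ℝ} (hA : 1 ≤ A) (hB : B ≤ N)
    (h : ∀ i ∈ movable N, A ≤ (i : ℕ) + 1 → ((i : ℕ) : ℝ) + 1 ≤ B → i ∈ T) :
    √B - √A - 2 ≤ (T.card : ℝ) := by
  have hA1 : 1 ≤ √A := Real.one_le_sqrt.2 hA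
  rcases lt_or_ge B 0 with hB0 | hB0
  · rw [Real.sqrt_eq_zero_of_nonpos hB0.le]
    have : (0 : ℝ) ≤ T.card := by positivity
    linarith
  have hsub : (Finset.Icc ⌈√A⌉₊ ⌊√B⌋₊).erase 1 ⊆ T.image fun i : Fin N => Nat.sqrt (i + 1) := by
    intro q hq
    rw [Finset.mem_erase, Finset.mem_Icc] at hq
    obtain ⟨hq1, hqA, hqB⟩ := hq
    have h1 : (q : ℝ) ≤ √B := (Nat.le_floor_iff (Real.sqrt_nonneg B)).1 hqB
    have h2 : (q : ℝ) ^ 2 ≤ B := (Real.le_sqrt (by positivity) hB0).1 h1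
    have h3 : √A ≤ q := Nat.ceil_le.1 hqA
    have h4 : A ≤ (q : ℝ) ^ 2 := (Real.sqrt_le_left (by positivity)).1 h3
    have hqN : q ^ 2 ≤ N := by exact_mod_cast h2.trans hB
    have hq2 : 2 ≤ q := by
      have : (1 : ℝ) ≤ q := hA1.trans h3
      have : 1 ≤ q := by exact_mod_cast this
      omega
    have hpos : 0 < q ^ 2 := by positivity
    have hcast : ((q ^ 2 - 1 : ℕ) : ℝ) + 1 = (q : ℝ) ^ 2 := by
      rw [Nat.cast_sub (by omega)]; push_cast; ring
    rw [Finset.mem_image]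
    refine ⟨⟨q ^ 2 - 1, by omega⟩, h _ ?_ ?_ ?_, ?_⟩
    · rw [mem_movable]
      exact Or.inr ⟨q, hq2, hqN, Nat.sub_add_cancel (by omega)⟩
    · simp only [hcast]; exact h4
    · simp only [hcast]; exact h2
    · simp only
      rw [Nat.sub_add_cancel (by omega), pow_two, Nat.sqrt_eq]
  have h1 := (Finset.card_le_card hsub).trans Finset.card_image_le
  have h2 := Finset.pred_card_le_card_erase (s := Finset.Icc ⌈√A⌉₊ ⌊√B⌋₊) (a := 1)
  rw [Nat.card_Icc] at h2
  have h3 : ⌊√B⌋₊ ≤ T.card + ⌈√A⌉₊ := by omega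
  have h3 : (⌊√B⌋₊ : ℝ) ≤ T.card + ⌈√A⌉₊ := by exact_mod_cast h3
  have h4 := Nat.ceil_lt_add_one (Real.sqrt_nonneg A)
  have h5 := Nat.lt_floor_add_one √B
  linarith

/-- A window that contains two consecutive blocks therefore contains an unmoved one, which fixes the
start of the surrounding word. -/
lemma movable_succ_notMem {N : ℕ} {i i' : Fin N} (h : (i' : ℕ) = i + 1) :
    i ∉ movable N ∨ i' ∉ movable N := by
  rw [mem_movable, mem_movable, ← not_and_or]
  rintro ⟨h1 | ⟨a, ha, -, h1⟩, h2 | ⟨b, hb, -, h2⟩⟩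
  · simp at h1 h2; omega
  · simp at h1
    have : b = 1 ∨ 2 ≤ b := by omega
    nlinarith
  · simp at h2; nlinarith
  · have h3 : a ^ 2 + 1 = b ^ 2 := by omega
    have h4 : a < b := lt_of_pow_lt_pow_left₀ 2 (Nat.zero_le _) (by omega)
    nlinarith

lemma factorial_add_le (a s : ℕ) : (a + s).factorial ≤ a.factorial * (a + s) ^ s := by
  rw [← Nat.factorial_mul_ascFactorial]
  exact Nat.mul_le_mul_left _ (Nat.ascFactorial_le_pow_add a s)

lemma two_pow_pred_le_factorial (s : ℕ) : 2 ^ (s - 1) ≤ s.factorial := by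
  induction s with
  | zero => simp
  | succ s ih =>
    rw [Nat.factorial_succ]
    rcases Nat.eq_zero_or_pos s with rfl | hs
    · simp
    · rw [show s + 1 - 1 = s - 1 + 1 by omega, pow_succ, mul_comm]
      exact Nat.mul_le_mul (by omega) ih

namespace IsMarkerConstruction

variable {l₁ : ℕ} {C : ℕ → List (List Bool)} {μ : Measure (ℤ → Bool)}

lemma exists_isStart_le (hC : IsMarkerConstruction l₁ C) {x : ℤ → Bool}
    (hx : x ∈ generatedSubshift C) (j : ℕ) (b : ℤ) :
    ∃ a, IsStart l₁ C j x a ∧ a ≤ b ∧ b < a + wordLength l₁ C j := by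
  obtain ⟨a, ha⟩ := hC.exists_isStart hx j
  have hpos : (0 : ℤ) < wordLength l₁ C j := by exact_mod_cast hC.wordLength_pos j
  have h1 := Int.emod_nonneg (b - a) hpos.ne'
  have h2 := Int.emod_lt_of_pos (b - a) hpos
  refine ⟨b - (b - a) % wordLength l₁ C j, ?_, by omega, by omega⟩
  rw [hC.isStart_iff_dvd hx ha]
  have := Int.emod_add_mul_ediv (b - a) (wordLength l₁ C j : ℤ)
  exact ⟨(b - a) / wordLength l₁ C j, by linarith⟩

lemma mem_of_mem_permWords (hC : IsMarkerConstruction l₁ C) {k : ℕ}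
    {R : Finset (Fin (C k).length)} {π₀ : Equiv.Perm (Fin (C k).length)}
    (hR : R ⊆ movable _) (hπ₀ : ∀ i, i ∉ movable (C k).length → π₀ i = i) :
    ∀ w ∈ permWords (C k) R π₀, w ∈ C (k + 1) := by
  intro w hw
  rw [← List.mem_toFinset, hC.toFinset_succ]
  obtain ⟨π, hπ, rfl⟩ := mem_permWords.1 hw
  refine mem_permWords.2 ⟨π, fun i hi => ?_, rfl⟩
  rw [hπ i fun h => hi (hR h), hπ₀ i hi, Equiv.Perm.one_apply]

lemma wordLength_succ_succ (hC : IsMarkerConstruction l₁ C) (k : ℕ) :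
    wordLength l₁ C (k + 2) =
      (movable (C k).length).card.factorial * wordLength l₁ C (k + 1) := by
  rw [← hC.length_succ_eq_card]
  rfl

/-- Lower bound for the measure of a cylinder: the blocks in `R` do not meet the window. -/
lemma le_measure_cylinderAt (hC : IsMarkerConstruction l₁ C)
    (hμ : IsInvariantProbabilityOn (generatedSubshift C) μ) {k : ℕ} {x : ℤ → Bool} {r n : ℕ}
    (hr : IsStart l₁ C (k + 1) x (-(r : ℤ))) (hrn : r + n ≤ wordLength l₁ C (k + 1))
    {R : Finset (Fin (C k).length)} (hR : R ⊆ movable _)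
    (hout : ∀ i ∈ R, ((i : ℕ) + 1) * wordLength l₁ C k ≤ r ∨
      r + n ≤ (i : ℕ) * wordLength l₁ C k) :
    (R.card.factorial : ENNReal) * (wordLength l₁ C (k + 2) : ENNReal)⁻¹ ≤
      μ (cylinderAt (generatedSubshift C) n x) := by
  obtain ⟨π₀, hπ₀, hb⟩ := hC.isStart_succ_iff.1 hr
  rw [← hC.card_permWords R π₀, ← hC.measure_block_mem hμ (k + 1) (r := r)
    (hC.mem_of_mem_permWords hR hπ₀)]
  have hX : μ (generatedSubshift C)ᶜ = 0 := hμ.compl_null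
  rw [← Measure.measure_inter_eq_of_ae (show ∀ᵐ y ∂μ, y ∈ generatedSubshift C by rwa [ae_iff])]
  refine measure_mono fun y hy => mem_cylinderAt_iff.2 ⟨hy.1, ?_⟩
  obtain ⟨π, hπ, hw⟩ := mem_permWords.1 hy.2
  have hb' := hC.isPermutedConcat_block_iff.1 hw.symm
  have hH := hC.wordLength_pos k
  set H := wordLength l₁ C k with hHdef
  rw [block_eq_block_iff]
  intro t ht
  have hlt : (r + t) / H < (C k).length := by
    apply Nat.div_lt_of_lt_mul
    have : r + t < wordLength l₁ C (k + 1) := by omega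
    rwa [wordLength, mul_comm] at this
  have hdm := Nat.div_add_mod' (r + t) H
  have hml := Nat.mod_lt (r + t) hH
  have hnR : (⟨(r + t) / H, hlt⟩ : Fin (C k).length) ∉ R := by
    intro hi
    rcases hout _ hi with h | h
    · simp only [add_mul, one_mul] at h; omega
    · simp only at h; omega
  have e1 := hb ⟨(r + t) / H, hlt⟩
  have e2 := hb' ⟨(r + t) / H, hlt⟩
  rw [hπ _ hnR, ← e1] at e2
  have := block_eq_block_iff.1 e2 ((r + t) % H) hml
  zify at hdm
  push_cast at this
  rw [show -(r : ℤ) + ((r : ℤ) + t) / H * H + ((r : ℤ) + t) % H = 0 + t by linarith] at this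
  exact this

/-- Upper bound for the measure of a cylinder: all blocks that can be moved but do not lie inside
the window are in `R`, and some block that cannot be moved lies inside the window. -/
lemma measure_cylinderAt_le (hC : IsMarkerConstruction l₁ C)
    (hμ : IsInvariantProbabilityOn (generatedSubshift C) μ) {k : ℕ} {x : ℤ → Bool} {r n : ℕ}
    (hr : IsStart l₁ C (k + 1) x (-(r : ℤ)))
    {R : Finset (Fin (C k).length)} (hR : R ⊆ movable _)
    (hin : ∀ i ∈ movable (C k).length, i ∉ R → r ≤ (i : ℕ) * wordLength l₁ C k ∧
      ((i : ℕ) + 1) * wordLength l₁ C k ≤ r + n)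
    {i₀ : Fin (C k).length} (hi₀ : i₀ ∉ movable (C k).length)
    (h₀ : r ≤ (i₀ : ℕ) * wordLength l₁ C k) (h₀' : ((i₀ : ℕ) + 1) * wordLength l₁ C k ≤ r + n) :
    μ (cylinderAt (generatedSubshift C) n x) ≤
      (R.card.factorial : ENNReal) * (wordLength l₁ C (k + 2) : ENNReal)⁻¹ := by
  obtain ⟨π₀, hπ₀, hb⟩ := hC.isStart_succ_iff.1 hr
  rw [← hC.card_permWords R π₀, ← hC.measure_block_mem hμ (k + 1) (r := r)
    (hC.mem_of_mem_permWords hR hπ₀)]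
  refine measure_mono fun y hy => ?_
  obtain ⟨hyX, hyx⟩ := mem_cylinderAt_iff.1 hy
  have hH := hC.wordLength_pos k
  have hsub : ∀ i : Fin (C k).length, r ≤ (i : ℕ) * wordLength l₁ C k →
      ((i : ℕ) + 1) * wordLength l₁ C k ≤ r + n →
      block y (-(r : ℤ) + (i : ℕ) * wordLength l₁ C k) (wordLength l₁ C k) =
        (C k).get (π₀ i) := by
    intro i h1 h2
    rw [← hb i]
    have := block_congr_of_le hyx (t := (i : ℕ) * wordLength l₁ C k - r)
      (m := wordLength l₁ C k) (by rw [add_mul, one_mul] at h2; omega)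
    rw [Nat.cast_sub h1, Nat.cast_mul] at this
    convert this using 2 <;> ring
  -- The unmoved word at `i₀` is visible in `y`. In the level-(k+1) word of `y` around it, it can
  -- stand only at place `i₀`, so that word also starts at -r. Without such a block, `y` could be
  -- cut at a different offset.
  have hy₀ := hsub i₀ h₀ h₀'
  rw [hπ₀ _ hi₀] at hy₀
  have hy0 : IsStart l₁ C k y (-(r : ℤ) + (i₀ : ℕ) * wordLength l₁ C k) := by
    unfold IsStart
    rw [hy₀]
    exact List.get_mem _ _
  obtain ⟨a, ha, hab, hba⟩ := hC.exists_isStart_le hyX (k + 1)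
    (-(r : ℤ) + (i₀ : ℕ) * wordLength l₁ C k)
  obtain ⟨π, hπ, hbπ⟩ := hC.isStart_succ_iff.1 ha
  have ha0 := IsStart.sub hC ha (hC.length_pos k)
  obtain ⟨q, hq⟩ := (hC.isStart_iff_dvd hyX ha0 _).1 hy0
  simp only [Nat.cast_zero, zero_mul, add_zero] at hq
  have hHz : (0 : ℤ) < wordLength l₁ C k := by exact_mod_cast hH
  have hq0 : 0 ≤ q := by
    by_contra hneg
    have : wordLength l₁ C k * q < 0 := mul_neg_of_pos_of_neg hHz (not_le.1 hneg)
    omega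
  lift q to ℕ using hq0
  have hqN : q < (C k).length := by
    simp only [wordLength] at hba
    push_cast at hba
    have : (wordLength l₁ C k : ℤ) * q < wordLength l₁ C k * (C k).length := by
      rw [← hq, mul_comm (wordLength l₁ C k : ℤ)]; linarith
    exact_mod_cast lt_of_mul_lt_mul_left this hHz.le
  have e1 := hbπ ⟨q, hqN⟩
  have e1' : a + ((q : ℕ) : ℤ) * wordLength l₁ C k =
      -(r : ℤ) + (i₀ : ℕ) * wordLength l₁ C k := by linarith
  simp only [e1'] at e1
  rw [hy₀, (hC.nodup k).get_inj_iff] at e1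
  have hqi : (⟨q, hqN⟩ : Fin (C k).length) = i₀ := π.injective (by rw [← e1, hπ _ hi₀])
  have haR : a = -(r : ℤ) := by
    have : q = (i₀ : ℕ) := congrArg Fin.val hqi
    rw [this] at e1'
    linarith
  subst haR
  change block y (-(r : ℤ)) (wordLength l₁ C (k + 1)) ∈ permWords (C k) R π₀
  refine mem_permWords.2 ⟨π, fun i hi => ?_, (hC.isPermutedConcat_block_iff.2 hbπ).symm⟩
  by_cases him : i ∈ movable (C k).length
  · obtain ⟨h1, h2⟩ := hin i him hi
    have := hsub i h1 h2
    rw [hbπ i, (hC.nodup k).get_inj_iff] at this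
    exact this
  · rw [hπ i him, hπ₀ i him]

/-- The information `- log μ(P_n(x))`. -/
noncomputable def info (C : ℕ → List (List Bool)) (μ : Measure (ℤ → Bool)) (x : ℤ → Bool)
    (n : ℕ) : ℝ :=
  -Real.log (μ.real (cylinderAt (generatedSubshift C) n x))

lemma info_nonneg (hμ : IsInvariantProbabilityOn (generatedSubshift C) μ) (x : ℤ → Bool) (n : ℕ) :
    0 ≤ info C μ x n := by
  have := hμ.isProbabilityMeasure
  exact neg_nonneg.2 (Real.log_nonpos measureReal_nonneg measureReal_le_one)

lemma info_le (hC : IsMarkerConstruction l₁ C)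
    (hμ : IsInvariantProbabilityOn (generatedSubshift C) μ) {k : ℕ} {x : ℤ → Bool} {r n : ℕ}
    (hr : IsStart l₁ C (k + 1) x (-(r : ℤ))) (hrn : r + n ≤ wordLength l₁ C (k + 1)) :
    0 < μ.real (cylinderAt (generatedSubshift C) n x) ∧
    info C μ x n ≤ Real.log (wordLength l₁ C (k + 1)) +
      (√((r + n : ℝ) / wordLength l₁ C k + 1) - √((r : ℝ) / wordLength l₁ C k) + 2) *
        Real.log (C k).length := by
  classical
  have := hμ.isProbabilityMeasure
  set H := wordLength l₁ C k with hHdef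
  have hH : 0 < H := hC.wordLength_pos k
  have hH' : (0 : ℝ) < H := by exact_mod_cast hH
  have hN : (1 : ℝ) ≤ (C k).length := by exact_mod_cast hC.length_pos k
  have hW : (0 : ℝ) < wordLength l₁ C (k + 1) := by exact_mod_cast hC.wordLength_pos (k + 1)
  -- Permuting the blocks outside the window keeps the point in the cylinder. `T` collects the
  -- movable blocks that meet the window.
  set R := (movable (C k).length).filter fun i : Fin (C k).length =>
    ((i : ℕ) + 1) * H ≤ r ∨ r + n ≤ (i : ℕ) * H with hR
  set T := (movable (C k).length).filter fun i : Fin (C k).length =>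
    ¬ (((i : ℕ) + 1) * H ≤ r ∨ r + n ≤ (i : ℕ) * H) with hT
  have hcard : R.card + T.card = (movable (C k).length).card :=
    Finset.card_filter_add_card_filter_not _
  have hlow := hC.le_measure_cylinderAt hμ hr hrn (R := R) (Finset.filter_subset _ _)
    (fun i hi => (Finset.mem_filter.1 hi).2)
  have hTcard : (T.card : ℝ) ≤ √((r + n : ℝ) / H + 1) - √((r : ℝ) / H) + 2 := by
    refine card_movable_le (Finset.filter_subset _ _) ?_ fun i hi => ?_
    · rw [add_div]
      have : (0 : ℝ) ≤ n / H := by positivity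
      linarith
    · have := (Finset.mem_filter.1 hi).2
      push Not at this
      obtain ⟨h1, h2⟩ := this
      have h1 : (r : ℝ) < ((i : ℕ) + 1) * H := by exact_mod_cast h1
      have h2 : ((i : ℕ) : ℝ) * H < r + n := by exact_mod_cast h2
      refine ⟨(div_le_iff₀ hH').2 h1.le, ?_⟩
      have := (lt_div_iff₀ hH').2 h2
      linarith
  -- Each of the `T` positions is charged a factor N_k, that is, log N_k in the information.
  have hfac : (movable (C k).length).card.factorial ≤ R.card.factorial * (C k).length ^ T.card := by
    rw [← hcard]
    refine (factorial_add_le _ _).trans (Nat.mul_le_mul_left _ (Nat.pow_le_pow_left ?_ _))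
    rw [hcard]
    simpa using Finset.card_le_univ (movable (C k).length)
  have hreal : (R.card.factorial : ℝ) * (wordLength l₁ C (k + 2) : ℝ)⁻¹ ≤
      μ.real (cylinderAt (generatedSubshift C) n x) := by
    have := ENNReal.toReal_mono (measure_ne_top _ _) hlow
    simpa [ENNReal.toReal_mul, ENNReal.toReal_inv, measureReal_def] using this
  have hge : ((wordLength l₁ C (k + 1) : ℝ) * ((C k).length : ℝ) ^ T.card)⁻¹ ≤
      μ.real (cylinderAt (generatedSubshift C) n x) := by
    refine le_trans ?_ hreal
    rw [hC.wordLength_succ_succ, Nat.cast_mul, ← div_eq_mul_inv, inv_eq_one_div,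
      div_le_div_iff₀ (by positivity) (by positivity)]
    have : ((movable (C k).length).card.factorial : ℝ) ≤
        R.card.factorial * ((C k).length : ℝ) ^ T.card := by exact_mod_cast hfac
    nlinarith
  have hpos : (0 : ℝ) < ((wordLength l₁ C (k + 1) : ℝ) * ((C k).length : ℝ) ^ T.card)⁻¹ := by
    positivity
  refine ⟨hpos.trans_le hge, ?_⟩
  have hlog := Real.log_le_log hpos hge
  rw [Real.log_inv, Real.log_mul hW.ne' (by positivity), Real.log_pow] at hlog
  have := mul_le_mul_of_nonneg_right hTcard (Real.log_nonneg hN)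
  unfold info
  linarith

lemma le_info (hC : IsMarkerConstruction l₁ C)
    (hμ : IsInvariantProbabilityOn (generatedSubshift C) μ) {k : ℕ} {x : ℤ → Bool} {r n : ℕ}
    (hr : IsStart l₁ C (k + 1) x (-(r : ℤ))) (hrn : r + n ≤ wordLength l₁ C (k + 1))
    (hn : 3 * wordLength l₁ C k ≤ n) :
    (√((r + n : ℝ) / wordLength l₁ C k) - √((r : ℝ) / wordLength l₁ C k + 1) - 3) * Real.log 2 ≤
      info C μ x n := by
  classical
  have := hμ.isProbabilityMeasure
  have hpos := (hC.info_le hμ hr hrn).1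
  set H := wordLength l₁ C k with hHdef
  have hH : 0 < H := hC.wordLength_pos k
  have hH' : (0 : ℝ) < H := by exact_mod_cast hH
  have hW1 : 0 < wordLength l₁ C (k + 1) := hC.wordLength_pos (k + 1)
  have hW : (0 : ℝ) < wordLength l₁ C (k + 1) := by exact_mod_cast hW1
  have hrn' : r + n ≤ (C k).length * H := hrn
  set T := (movable (C k).length).filter fun i : Fin (C k).length =>
    r ≤ (i : ℕ) * H ∧ ((i : ℕ) + 1) * H ≤ r + n with hT
  set R := (movable (C k).length).filter fun i : Fin (C k).length =>
    ¬ (r ≤ (i : ℕ) * H ∧ ((i : ℕ) + 1) * H ≤ r + n) with hR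
  have hcard : T.card + R.card = (movable (C k).length).card :=
    Finset.card_filter_add_card_filter_not _
  -- A window of length at least 3H contains two full consecutive blocks, at least one of which is
  -- unmoved.
  obtain ⟨i₀, hi₀, h1, h2⟩ : ∃ i₀ : Fin (C k).length, i₀ ∉ movable (C k).length ∧
      r ≤ (i₀ : ℕ) * H ∧ ((i₀ : ℕ) + 1) * H ≤ r + n := by
    have hdm := Nat.div_add_mod' r H
    have hml := Nat.mod_lt r hH
    have e1 : (r / H + 1) * H = r / H * H + H := by ring
    have e2 : (r / H + 1 + 1) * H = r / H * H + 2 * H := by ring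
    have e3 : (r / H + 1 + 1 + 1) * H = r / H * H + 3 * H := by ring
    have hlt : r / H + 1 + 1 < (C k).length := by
      have : (r / H + 1 + 1 + 1) * H ≤ (C k).length * H := by omega
      exact Nat.le_of_mul_le_mul_right this hH
    rcases movable_succ_notMem (i := ⟨r / H + 1, by omega⟩) (i' := ⟨r / H + 1 + 1, hlt⟩) rfl
      with h | h
    · exact ⟨_, h, by simp only; omega, by simp only; omega⟩
    · exact ⟨_, h, by simp only; omega, by simp only; omega⟩
  have hup := hC.measure_cylinderAt_le hμ hr (R := R) (n := n) (Finset.filter_subset _ _)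
    (fun i hi hiR => by
      by_contra hcon
      exact hiR (Finset.mem_filter.2 ⟨hi, hcon⟩)) hi₀ h1 h2
  have hTcard : √((r + n : ℝ) / H) - √((r : ℝ) / H + 1) - 2 ≤ (T.card : ℝ) := by
    refine le_card_movable ?_ ?_ fun i hi hA hB => ?_
    · have : (0 : ℝ) ≤ r / H := by positivity
      linarith
    · rw [div_le_iff₀ hH']; exact_mod_cast hrn'
    · refine Finset.mem_filter.2 ⟨hi, ?_, ?_⟩
      · have : (r : ℝ) / H ≤ (i : ℕ) := by linarith
        rw [div_le_iff₀ hH'] at this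
        exact_mod_cast this
      · rw [le_div_iff₀ hH'] at hB
        exact_mod_cast hB
  -- A crude lower bound is enough: at least log 2 per position after the first, as the factor log
  -- N_k does not affect the exponent.
  have hfac : R.card.factorial * 2 ^ (T.card - 1) ≤ (movable (C k).length).card.factorial := by
    rw [← hcard, add_comm]
    refine (Nat.mul_le_mul_left _ (two_pow_pred_le_factorial _)).trans ?_
    exact Nat.le_of_dvd (Nat.factorial_pos _) (Nat.factorial_mul_factorial_dvd_factorial_add _ _)
  have hreal : μ.real (cylinderAt (generatedSubshift C) n x) ≤
      (R.card.factorial : ℝ) * (wordLength l₁ C (k + 2) : ℝ)⁻¹ := by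
    have := ENNReal.toReal_mono (ENNReal.mul_ne_top (ENNReal.natCast_ne_top _) (by
      rw [ENNReal.inv_ne_top]
      exact_mod_cast (hC.wordLength_pos (k + 2)).ne')) hup
    simpa [ENNReal.toReal_mul, ENNReal.toReal_inv, measureReal_def] using this
  have hle : μ.real (cylinderAt (generatedSubshift C) n x) ≤ ((2 : ℝ) ^ (T.card - 1))⁻¹ := by
    refine hreal.trans ?_
    rw [← div_eq_mul_inv, inv_eq_one_div, div_le_div_iff₀ (by
      exact_mod_cast hC.wordLength_pos (k + 2)) (by positivity), one_mul, hC.wordLength_succ_succ]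
    have : R.card.factorial * 2 ^ (T.card - 1) ≤
        (movable (C k).length).card.factorial * wordLength l₁ C (k + 1) :=
      hfac.trans (Nat.le_mul_of_pos_right _ hW1)
    exact_mod_cast this
  have hlog := Real.log_le_log hpos hle
  rw [Real.log_inv, Real.log_pow] at hlog
  have h2 : (0 : ℝ) ≤ Real.log 2 := Real.log_nonneg (by norm_num)
  have h3 : (T.card : ℝ) - 1 ≤ ((T.card - 1 : ℕ) : ℝ) := by
    have : T.card ≤ T.card - 1 + 1 := by omega
    have : (T.card : ℝ) ≤ ((T.card - 1 : ℕ) : ℝ) + 1 := by exact_mod_cast this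
    linarith
  have h4 : (√((r + n : ℝ) / H) - √((r : ℝ) / H + 1) - 3) * Real.log 2 ≤
      ((T.card - 1 : ℕ) : ℝ) * Real.log 2 := mul_le_mul_of_nonneg_right (by linarith) h2
  unfold info
  linarith

end IsMarkerConstruction

/-! ### Generic points and the upper bound with exponent 1/2 -/

lemma sq_mul_le_two_pow {j : ℕ} (hj : 10 ≤ j) : 4 * (j + 4) ^ 2 ≤ 2 ^ j := by
  induction j, hj using Nat.le_induction with
  | base => norm_num
  | succ j hj ih => rw [pow_succ 2]; nlinarith

lemma tendsto_log_div_rpow {s : ℝ} (hs : 0 < s) :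
    Tendsto (fun x : ℝ => Real.log x / x ^ s) atTop (𝓝 0) :=
  (isLittleO_log_rpow_atTop hs).tendsto_div_nhds_zero

/-- Subadditivity of the square root removes `r`: wherever the window lies, it meets at most of
order √(m/h) squares. The factor √h in the bound for `L` cancels the 1/√h. -/
lemma sqrt_sub_sqrt_mul_le {h m n r L : ℝ} (hh : 1 ≤ h) (hhm : h ≤ m) (hn : 0 ≤ n) (hnm : n ≤ m)
    (hr : 0 ≤ r) (hL0 : 0 ≤ L) (hL : L ≤ √h * Real.log h) :
    (√((r + n) / h + 1) - √(r / h) + 2) * L ≤ 4 * (√m * Real.log m) := by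
  have hh0 : 0 < h := by linarith
  have hm0 : 0 < m := by linarith
  have hsh : 0 < √h := Real.sqrt_pos.2 hh0
  have h1 : √((r + n) / h + 1) ≤ √(r / h) + √(n / h + 1) := by
    rw [add_div, add_assoc]
    have hx : 0 ≤ r / h := by positivity
    have hy : 0 ≤ n / h + 1 := by positivity
    rw [Real.sqrt_le_left (by positivity), add_sq, Real.sq_sqrt hx, Real.sq_sqrt hy]
    have : 0 ≤ √(r / h) * √(n / h + 1) := by positivity
    linarith
  have hone : 1 ≤ √m / √h := (one_le_div hsh).2 (Real.sqrt_le_sqrt hhm)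
  have h2 : √(n / h + 1) ≤ 2 * (√m / √h) := by
    rw [← Real.sqrt_div hm0.le]
    rw [Real.sqrt_le_left (by positivity), mul_pow, Real.sq_sqrt (by positivity)]
    have h3 : n / h ≤ m / h := by gcongr
    have h4 : 1 ≤ m / h := (one_le_div hh0).2 hhm
    linarith
  have h3 : √((r + n) / h + 1) - √(r / h) + 2 ≤ 4 * (√m / √h) := by linarith
  calc _ ≤ 4 * (√m / √h) * L := mul_le_mul_of_nonneg_right h3 hL0
    _ ≤ 4 * (√m / √h) * (√h * Real.log h) := by gcongr
    _ = 4 * (√m * Real.log h) := by field_simp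
    _ ≤ _ := by gcongr

namespace IsMarkerConstruction

variable {l₁ : ℕ} {C : ℕ → List (List Bool)} {μ : Measure (ℤ → Bool)}

lemma two_pow_le_length (hC : IsMarkerConstruction l₁ C) (hl₁ : 25 ≤ l₁) (j : ℕ) :
    2 ^ j ≤ (C j).length := by
  have := hC.le_length hl₁ j
  have : 0 < 2 ^ j := by positivity
  omega

lemma tendsto_length (hC : IsMarkerConstruction l₁ C) (hl₁ : 25 ≤ l₁) :
    Tendsto (fun j => ((C j).length : ℝ)) atTop atTop :=
  tendsto_natCast_atTop_atTop.comp <| tendsto_atTop_mono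
    (fun j => Nat.lt_two_pow_self.le.trans (hC.two_pow_le_length hl₁ j)) tendsto_id

lemma log_wordLength_succ (hC : IsMarkerConstruction l₁ C) (j : ℕ) :
    Real.log (wordLength l₁ C (j + 1)) =
      Real.log (C j).length + Real.log (wordLength l₁ C j) := by
  have h1 : ((C j).length : ℝ) ≠ 0 := by exact_mod_cast (hC.length_pos j).ne'
  have h2 : (wordLength l₁ C j : ℝ) ≠ 0 := by exact_mod_cast (hC.wordLength_pos j).ne'
  rw [wordLength, Nat.cast_mul, Real.log_mul h1 h2]

/-- Here N_{j+1} = p! ≤ p^p with p = ⌊√N_j⌋, and N_j ≤ H_{j+1}. This is the origin of the exponent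
1/2 in the upper bound. -/
lemma log_length_le (hC : IsMarkerConstruction l₁ C) (hl₁ : 25 ≤ l₁) (j : ℕ) :
    Real.log (C (j + 1)).length ≤
      √(wordLength l₁ C (j + 1)) * Real.log (wordLength l₁ C (j + 1)) := by
  rw [hC.length_succ hl₁]
  set N := (C j).length with hN
  have hN0 : 32 ≤ N := by
    have := hC.le_length hl₁ j
    have h0 : 0 < 2 ^ j := by positivity
    omega
  have hp : 5 ≤ Nat.sqrt N := Nat.le_sqrt.2 (by omega)
  have hNW : (N : ℝ) ≤ wordLength l₁ C (j + 1) := by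
    have : N ≤ wordLength l₁ C (j + 1) := Nat.le_mul_of_pos_right _ (hC.wordLength_pos j)
    exact_mod_cast this
  have hN1 : (1 : ℝ) ≤ N := by exact_mod_cast (by omega : 1 ≤ N)
  have hf : ((Nat.sqrt N).factorial : ℝ) ≤ (Nat.sqrt N : ℝ) ^ Nat.sqrt N := by
    exact_mod_cast Nat.factorial_le_pow _
  have hs0 : (0 : ℝ) < Nat.sqrt N := by exact_mod_cast (by omega : 0 < Nat.sqrt N)
  have h1 : (Nat.sqrt N : ℝ) ≤ √N := Real.nat_sqrt_le_real_sqrt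
  have h2 : (Nat.sqrt N : ℝ) ≤ N := by exact_mod_cast Nat.sqrt_le_self N
  calc Real.log (Nat.sqrt N).factorial ≤ Real.log ((Nat.sqrt N : ℝ) ^ Nat.sqrt N) :=
        Real.log_le_log (by exact_mod_cast Nat.factorial_pos _) hf
    _ = Nat.sqrt N * Real.log (Nat.sqrt N) := Real.log_pow _ _
    _ ≤ √N * Real.log N := by
        gcongr
    _ ≤ _ := by
        gcongr

/-- One has log H_{j+1} = log N_j + log H_j ≤ 5 log N_j, whereas log N_{j+1} is at least (√N_j - 2)
log 2. -/
lemma eventually_wordLength_le_rpow (hC : IsMarkerConstruction l₁ C) (hl₁ : 25 ≤ l₁)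
    (hsq : IsSquare l₁) {ε : ℝ} (hε : 0 < ε) :
    ∀ᶠ j in atTop, (wordLength l₁ C j : ℝ) ≤ ((C j).length : ℝ) ^ ε := by
  have hl2 : 0 < Real.log 2 := Real.log_pos (by norm_num)
  have hlim := (tendsto_log_div_rpow (s := 1 / 2) (by norm_num)).comp (hC.tendsto_length hl₁)
  have hev := hlim.eventually_lt_const (u := ε * Real.log 2 / 10) (by positivity)
  have hev2 := (hC.tendsto_length hl₁).eventually_ge_atTop 16
  rw [← map_add_atTop_eq_nat 1, eventually_map]
  filter_upwards [hev, hev2] with j hj hj2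
  simp only [Function.comp] at hj
  rw [← Real.sqrt_eq_rpow] at hj
  have hNpos : 0 < (C (j + 1)).length := hC.length_pos _
  have hWpos : (0 : ℝ) < wordLength l₁ C (j + 1) := by exact_mod_cast hC.wordLength_pos _
  set N := (C j).length with hN
  have hs4 : 4 ≤ √(N : ℝ) := Real.le_sqrt_of_sq_le (by norm_num; exact_mod_cast hj2)
  rw [div_lt_iff₀ (by linarith)] at hj
  have h1 : Real.log (wordLength l₁ C j) ≤ 4 * Real.log N := by
    rw [show (4 : ℝ) = (4 : ℕ) by norm_num, ← Real.log_pow]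
    refine Real.log_le_log (by exact_mod_cast hC.wordLength_pos j) ?_
    exact_mod_cast hC.wordLength_le_pow hl₁ hsq j
  have h2 : (√N - 2) * Real.log 2 ≤ Real.log (C (j + 1)).length := by
    have h3 : (2 : ℝ) ^ (Nat.sqrt N - 1) ≤ (C (j + 1)).length := by
      rw [hC.length_succ hl₁]
      exact_mod_cast two_pow_pred_le_factorial _
    have h4 := Real.log_le_log (by positivity) h3
    rw [Real.log_pow] at h4
    refine le_trans (mul_le_mul_of_nonneg_right ?_ hl2.le) h4
    have h5 : √(N : ℝ) ≤ Nat.sqrt N + 1 := Real.real_sqrt_le_nat_sqrt_succ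
    have h6 : (Nat.sqrt N : ℝ) ≤ ((Nat.sqrt N - 1 : ℕ) : ℝ) + 1 := by
      exact_mod_cast (by omega : Nat.sqrt N ≤ Nat.sqrt N - 1 + 1)
    linarith
  rw [← Real.log_le_log_iff hWpos (Real.rpow_pos_of_pos (by exact_mod_cast hNpos) _),
    Real.log_rpow (by exact_mod_cast hNpos), hC.log_wordLength_succ]
  have h3 : ε * ((√N - 2) * Real.log 2) ≤ ε * Real.log (C (j + 1)).length := by gcongr
  have h4 : 0 ≤ ε * Real.log 2 * (√N - 4) :=
    mul_nonneg (by positivity) (by linarith)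
  nlinarith

/-- At level `j`, the origin is not close to the ends of its block of `x`. -/
def IsGeneric (l₁ : ℕ) (C : ℕ → List (List Bool)) (j : ℕ) (x : ℤ → Bool) : Prop :=
  ∃ r : ℕ, IsStart l₁ C j x (-(r : ℤ)) ∧ wordLength l₁ C j / (j + 2) ^ 2 ≤ r ∧
    r + wordLength l₁ C j / (j + 2) ^ 2 ≤ wordLength l₁ C j

lemma measure_not_isGeneric_le (hC : IsMarkerConstruction l₁ C)
    (hμ : IsInvariantProbabilityOn (generatedSubshift C) μ) (j : ℕ) :
    μ {x | x ∈ generatedSubshift C ∧ ¬ IsGeneric l₁ C j x} ≤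
      ENNReal.ofReal (2 * (1 / ((j + 2 : ℕ) : ℝ) ^ 2)) := by
  set H := wordLength l₁ C j with hH
  set e := H / (j + 2) ^ 2 with he
  have hHpos : 0 < H := hC.wordLength_pos j
  have hsub : {x | x ∈ generatedSubshift C ∧ ¬ IsGeneric l₁ C j x} ⊆
      ⋃ r ∈ Finset.range e ∪ Finset.Ioc (H - e) H, {x | IsStart l₁ C j x (-(r : ℤ))} := by
    rintro x ⟨hx, hg⟩
    obtain ⟨r, hr, hs⟩ := hC.exists_offset hx j
    refine Set.mem_biUnion (x := r) ?_ hs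
    by_contra hcon
    simp only [Finset.coe_union, Finset.coe_range, Finset.coe_Ioc, Set.mem_union, Set.mem_Iio,
      Set.mem_Ioc, not_or, not_lt, not_and] at hcon
    have heH : e ≤ H := Nat.div_le_self _ _
    have hre : r + e ≤ H := by
      by_contra hlt
      have := hcon.2 (by omega)
      omega
    exact hg ⟨r, hs, hcon.1, hre⟩
  have heD : e * (j + 2) ^ 2 ≤ H := Nat.div_mul_le_self _ _
  calc _ ≤ ∑ r ∈ Finset.range e ∪ Finset.Ioc (H - e) H, μ {x | IsStart l₁ C j x (-(r : ℤ))} :=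
        (measure_mono hsub).trans (measure_biUnion_finset_le _ _)
    _ = ((Finset.range e ∪ Finset.Ioc (H - e) H).card : ENNReal) * (H : ENNReal)⁻¹ := by
        simp only [hC.measure_isStart hμ, Finset.sum_const, nsmul_eq_mul, ← hH]
    _ ≤ ((2 * e : ℕ) : ENNReal) * (H : ENNReal)⁻¹ := by
        gcongr
        refine (Finset.card_union_le _ _).trans ?_
        rw [Finset.card_range, Nat.card_Ioc]
        omega
    _ = ENNReal.ofReal ((2 * e : ℕ) / H) := by
        rw [ENNReal.ofReal_div_of_pos (by exact_mod_cast hHpos), ENNReal.ofReal_natCast,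
          ENNReal.ofReal_natCast, div_eq_mul_inv]
    _ ≤ _ := by
        apply ENNReal.ofReal_le_ofReal
        rw [mul_one_div, div_le_div_iff₀ (by exact_mod_cast hHpos) (by positivity)]
        have : 2 * e * (j + 2) ^ 2 ≤ 2 * H := by nlinarith
        exact_mod_cast this

/-- Borel–Cantelli: the offset is uniform, so level j fails with probability at most 2/(j+2)^2,
which is summable. -/
lemma ae_eventually_isGeneric (hC : IsMarkerConstruction l₁ C)
    (hμ : IsInvariantProbabilityOn (generatedSubshift C) μ) :
    ∀ᵐ x ∂μ, x ∈ generatedSubshift C ∧ ∀ᶠ j in atTop, IsGeneric l₁ C j x := by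
  have hsum : Summable fun j : ℕ => 2 * (1 / ((j + 2 : ℕ) : ℝ) ^ 2) :=
    ((summable_nat_add_iff (f := fun n : ℕ => 1 / (n : ℝ) ^ 2) 2).2
      (Real.summable_one_div_nat_pow.2 (by norm_num))).mul_left 2
  have hne : ∑' j, μ {x | x ∈ generatedSubshift C ∧ ¬ IsGeneric l₁ C j x} ≠ ⊤ :=
    ne_top_of_le_ne_top hsum.tsum_ofReal_ne_top
      (ENNReal.tsum_le_tsum fun j => hC.measure_not_isGeneric_le hμ j)
  have hX : ∀ᵐ x ∂μ, x ∈ generatedSubshift C := by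
    rw [ae_iff]; exact hμ.compl_null
  filter_upwards [hX, ae_eventually_notMem hne] with x hx hev
  refine ⟨hx, hev.mono fun j hj => ?_⟩
  by_contra hcon
  exact hj ⟨hx, hcon⟩

/-- The free bound `m` serves two cases: `m = n` when the window is longer than a block, and `m =
H_k` when it is shorter. -/
lemma info_le_sqrt_mul_log (hC : IsMarkerConstruction l₁ C) (hl₁ : 25 ≤ l₁)
    (hμ : IsInvariantProbabilityOn (generatedSubshift C) μ) {k : ℕ} (hk : 1 ≤ k) {x : ℤ → Bool}
    {r n m : ℕ} (hr : IsStart l₁ C (k + 1) x (-(r : ℤ)))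
    (hrn : r + n ≤ wordLength l₁ C (k + 1)) (hnm : n ≤ m) (hm : wordLength l₁ C k ≤ m) :
    0 < μ.real (cylinderAt (generatedSubshift C) n x) ∧
      info C μ x n ≤ 6 * (√m * Real.log m) := by
  obtain ⟨hpos, hle⟩ := hC.info_le hμ hr hrn
  refine ⟨hpos, hle.trans ?_⟩
  obtain ⟨k, rfl⟩ : ∃ k', k = k' + 1 := ⟨k - 1, by omega⟩
  have hW : (1 : ℝ) ≤ wordLength l₁ C (k + 1) := by exact_mod_cast hC.wordLength_pos _
  have hWm : (wordLength l₁ C (k + 1) : ℝ) ≤ m := by exact_mod_cast hm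
  have hm1 : (1 : ℝ) ≤ m := hW.trans hWm
  have hlog := hC.log_length_le hl₁ k
  have h1 := sqrt_sub_sqrt_mul_le hW hWm (Nat.cast_nonneg n) (by exact_mod_cast hnm)
    (Nat.cast_nonneg r) (Real.log_natCast_nonneg _) hlog
  have hlm : Real.log (wordLength l₁ C (k + 1)) ≤ Real.log m := Real.log_le_log (by linarith) hWm
  have hsm : 1 ≤ √(m : ℝ) := Real.one_le_sqrt.2 hm1
  have hl0 : 0 ≤ Real.log (m : ℝ) := Real.log_nonneg hm1
  have h2 : √(wordLength l₁ C (k + 1)) * Real.log (wordLength l₁ C (k + 1)) ≤ √m * Real.log m := by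
    gcongr
  have h3 : Real.log (m : ℝ) ≤ √m * Real.log m := le_mul_of_one_le_left hl0 hsm
  rw [hC.log_wordLength_succ]
  linarith

/-- Along a generic point, the information is of order at most `√n` up to logarithms. -/
lemma eventually_info_le (hC : IsMarkerConstruction l₁ C) (hl₁ : 25 ≤ l₁)
    (hμ : IsInvariantProbabilityOn (generatedSubshift C) μ) {x : ℤ → Bool}
    (hx : ∀ᶠ j in atTop, IsGeneric l₁ C j x) :
    ∀ᶠ n : ℕ in atTop, 0 < μ.real (cylinderAt (generatedSubshift C) n x) ∧
      info C μ x n ≤ 12 * (√n * Real.log n ^ 2) := by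
  obtain ⟨J₀, hJ₀⟩ := eventually_atTop.1 hx
  set J := max J₀ 10 with hJ
  filter_upwards [eventually_ge_atTop (wordLength l₁ C J)] with n hn
  have hex : ∃ m, n < wordLength l₁ C m :=
    ((hC.tendsto_wordLength hl₁).eventually_gt_atTop n).exists
  classical
  have hfind := Nat.find_spec hex
  have hmin := fun {m} => Nat.find_min hex (m := m)
  have hgt : J < Nat.find hex := by
    by_contra hle
    have := hC.wordLength_mono (not_lt.1 hle)
    omega
  obtain ⟨j, hj⟩ : ∃ j, Nat.find hex = j + 1 := ⟨Nat.find hex - 1, by omega⟩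
  rw [hj] at hfind hgt
  have hjn : wordLength l₁ C j ≤ n := not_lt.1 (hmin (by omega))
  have hj10 : 10 ≤ j := by omega
  obtain ⟨r, hr, hr1, hr2⟩ := hJ₀ (j + 1) (by omega)
  have hW25 := hC.le_wordLength hl₁ j
  have hn1 : (1 : ℝ) ≤ n := by exact_mod_cast (hC.wordLength_pos j).trans_le hjn
  -- Since n ≥ H_j ≥ 25 · 32^j ≥ e^{j+3}, the polynomial losses from genericity are absorbed by log
  -- n.
  have hlogn : ((j + 3 : ℕ) : ℝ) ≤ Real.log n := by
    rw [Real.le_log_iff_exp_le (by linarith), ← Real.exp_one_pow]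
    calc Real.exp 1 ^ (j + 3) ≤ 2.7182818286 ^ (j + 3) := by
          gcongr
          exact Real.exp_one_lt_d9.le
      _ = 2.7182818286 ^ 3 * 2.7182818286 ^ j := by ring
      _ ≤ 25 * 32 ^ j := by
          gcongr
          · norm_num
          · norm_num
      _ ≤ n := by exact_mod_cast hW25.trans hjn
  have hlog1 : 1 ≤ Real.log n := by
    refine le_trans ?_ hlogn
    exact_mod_cast (by omega : 1 ≤ j + 3)
  have hs0 := Real.sqrt_nonneg (n : ℝ)
  by_cases hcase : r + n ≤ wordLength l₁ C (j + 1)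
  · obtain ⟨hp, hle⟩ := hC.info_le_sqrt_mul_log hl₁ hμ (by omega) hr hcase le_rfl hjn
    refine ⟨hp, hle.trans ?_⟩
    have : √(n : ℝ) * Real.log n ≤ √n * Real.log n ^ 2 := by
      gcongr
      nlinarith
    have : 0 ≤ √(n : ℝ) * Real.log n := by positivity
    linarith
  -- The window leaves its word of level j + 1. Genericity there gives n ≥ H_{j+1}/(j+3)^2, so
  -- H_{j+1} may replace n at the cost of a logarithm. Genericity one level up keeps the window
  -- inside the word of level j + 2.
  · obtain ⟨r', hr', -, hr2'⟩ := hJ₀ (j + 2) (by omega)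
    set H := wordLength l₁ C (j + 1) with hH
    have hHpos : 0 < H := hC.wordLength_pos _
    have hWle : H ≤ wordLength l₁ C (j + 2) / (j + 2 + 2) ^ 2 := by
      rw [Nat.le_div_iff_mul_le (by positivity), mul_comm]
      refine Nat.mul_le_mul_right _ ?_
      have h1 := sq_mul_le_two_pow (j := j + 1) (by omega)
      have h2 := hC.two_pow_le_length hl₁ (j + 1)
      have : j + 1 + 4 = j + 2 + 2 + 1 := by omega
      rw [this] at h1
      nlinarith
    have hrn : r' + n ≤ wordLength l₁ C (j + 1 + 1) := by
      have : r' + wordLength l₁ C (j + 2) / (j + 2 + 2) ^ 2 ≤ wordLength l₁ C (j + 2) := hr2'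
      change r' + n ≤ wordLength l₁ C (j + 2)
      omega
    obtain ⟨hp, hle⟩ := hC.info_le_sqrt_mul_log hl₁ hμ (k := j + 1) (by omega) (n := n) (m := H) hr'
      hrn hfind.le le_rfl
    refine ⟨hp, hle.trans ?_⟩
    have hHn : H ≤ n * (j + 3) ^ 2 := by
      have h1 : H / (j + 1 + 2) ^ 2 < n := by omega
      have := (Nat.div_lt_iff_lt_mul (by positivity)).1 h1
      exact this.le
    have hDn : (j + 3) ^ 2 ≤ n := by
      have h1 := sq_mul_le_two_pow hj10
      have h2 : 2 ^ j ≤ 32 ^ j := Nat.pow_le_pow_left (by norm_num) j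
      nlinarith
    have hHn' : (H : ℝ) ≤ n * ((j + 3 : ℕ) : ℝ) ^ 2 := by exact_mod_cast hHn
    have hHn2 : (H : ℝ) ≤ (n : ℝ) ^ 2 := by
      have : H ≤ n ^ 2 := by nlinarith
      exact_mod_cast this
    have hH0 : (0 : ℝ) < H := by exact_mod_cast hHpos
    have h1 : √(H : ℝ) ≤ √n * Real.log n := by
      calc √(H : ℝ) ≤ √(n * ((j + 3 : ℕ) : ℝ) ^ 2) := Real.sqrt_le_sqrt hHn'
        _ = √n * (j + 3 : ℕ) := by rw [Real.sqrt_mul (by positivity), Real.sqrt_sq (by positivity)]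
        _ ≤ _ := by gcongr
    have h2 : Real.log H ≤ 2 * Real.log n := by
      have := Real.log_le_log hH0 hHn2
      rwa [Real.log_pow] at this
    calc 6 * (√(H : ℝ) * Real.log H) ≤ 6 * (√n * Real.log n * (2 * Real.log n)) := by
          gcongr
      _ = _ := by ring

lemma atomRate_eq (hμ : IsInvariantProbabilityOn (generatedSubshift C) μ) {x : ℤ → Bool} {n : ℕ}
    (h : 0 < μ.real (cylinderAt (generatedSubshift C) n x)) (β : ℝ) :
    atomRate (generatedSubshift C) μ x β n = ((info C μ x n / (n : ℝ) ^ β : ℝ) : EReal) := by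
  have := hμ.isProbabilityMeasure
  have e : μ (cylinderAt (generatedSubshift C) n x) =
      ENNReal.ofReal (μ.real (cylinderAt (generatedSubshift C) n x)) :=
    (ofReal_measureReal (measure_ne_top _ _)).symm
  rw [atomRate, e, ENNReal.log_ofReal_of_pos h, EReal.coe_div, info, EReal.coe_neg]

lemma tendsto_atomRate_zero (hC : IsMarkerConstruction l₁ C) (hl₁ : 25 ≤ l₁)
    (hμ : IsInvariantProbabilityOn (generatedSubshift C) μ) {x : ℤ → Bool}
    (hx : ∀ᶠ j in atTop, IsGeneric l₁ C j x) {β : ℝ} (hβ : 1 / 2 < β) :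
    Tendsto (atomRate (generatedSubshift C) μ x β) atTop (𝓝 0) := by
  have hev := hC.eventually_info_le hl₁ hμ hx
  have hreal : Tendsto (fun n : ℕ => info C μ x n / (n : ℝ) ^ β) atTop (𝓝 0) := by
    have hlim : Tendsto (fun n : ℕ => 12 * (Real.log n / (n : ℝ) ^ ((β - 1 / 2) / 2)) ^ 2) atTop
        (𝓝 (12 * 0 ^ 2)) :=
      (((tendsto_log_div_rpow (s := (β - 1 / 2) / 2) (by linarith)).comp
        tendsto_natCast_atTop_atTop).pow 2).const_mul 12
    rw [zero_pow two_ne_zero, mul_zero] at hlim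
    refine squeeze_zero' ?_ ?_ hlim
    · exact Eventually.of_forall fun n => div_nonneg (info_nonneg hμ x n) (by positivity)
    · filter_upwards [hev, eventually_gt_atTop 0] with n hn hn0
      have hn0' : (0 : ℝ) < n := by exact_mod_cast hn0
      rw [div_le_iff₀ (by positivity)]
      refine hn.2.trans (le_of_eq ?_)
      have e1 : (n : ℝ) ^ β = √n * ((n : ℝ) ^ ((β - 1 / 2) / 2)) ^ 2 := by
        rw [Real.sqrt_eq_rpow, ← Real.rpow_natCast, ← Real.rpow_mul hn0'.le,
          ← Real.rpow_add hn0']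
        congr 1
        push_cast
        ring
      rw [e1]
      field_simp
  have := (continuous_coe_real_ereal.tendsto 0).comp hreal
  rw [EReal.coe_zero] at this
  refine this.congr' ?_
  filter_upwards [hev] with n hn
  rw [atomRate_eq hμ hn.1]
  rfl

end IsMarkerConstruction

/-! ### Windows with a prescribed exponent -/

/-- The number of blocks of level `j` in the windows along which the exponent is
`(θ - 1 / 2) / θ`. -/
noncomputable def blockCount (C : ℕ → List (List Bool)) (θ : ℝ) (j : ℕ) : ℕ :=
  ⌊((C j).length : ℝ) ^ θ / (4 * (j + 3) ^ 2)⌋₊ + 1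

namespace IsMarkerConstruction

variable {l₁ : ℕ} {C : ℕ → List (List Bool)} {μ : Measure (ℤ → Bool)}

lemma one_le_length (hC : IsMarkerConstruction l₁ C) (j : ℕ) : (1 : ℝ) ≤ (C j).length := by
  exact_mod_cast hC.length_pos j

lemma blockCount_le (θ : ℝ) (j : ℕ) :
    (blockCount C θ j : ℝ) ≤ ((C j).length : ℝ) ^ θ / (4 * (j + 3) ^ 2) + 1 := by
  rw [blockCount, Nat.cast_add, Nat.cast_one]
  gcongr
  exact Nat.floor_le (by positivity)

lemma le_blockCount (θ : ℝ) (j : ℕ) :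
    ((C j).length : ℝ) ^ θ / (4 * (j + 3) ^ 2) ≤ blockCount C θ j := by
  rw [blockCount, Nat.cast_add, Nat.cast_one]
  exact (Nat.lt_floor_add_one _).le

lemma rpow_le_length (hC : IsMarkerConstruction l₁ C) {θ : ℝ} (hθ : θ ≤ 1) (j : ℕ) :
    ((C j).length : ℝ) ^ θ ≤ (C j).length := by
  simpa using Real.rpow_le_rpow_of_exponent_le (hC.one_le_length j) hθ

lemma strictMono_blockCount_mul (hC : IsMarkerConstruction l₁ C) (hl₁ : 25 ≤ l₁) {θ : ℝ}
    (hθ : θ ≤ 1) : StrictMono fun j => blockCount C θ j * wordLength l₁ C j := by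
  refine strictMono_nat_of_lt_succ fun j => ?_
  have h1 : blockCount C θ j < (C j).length := by
    have h2 := (blockCount_le (C := C) θ j)
    have h3 := hC.rpow_le_length hθ j
    have h4 : (32 : ℝ) ≤ (C j).length := by
      have := hC.le_length hl₁ j
      have h0 : 0 < 2 ^ j := by positivity
      exact_mod_cast (by omega : 32 ≤ (C j).length)
    have h5 : ((C j).length : ℝ) ^ θ / (4 * (j + 3) ^ 2) ≤ (C j).length / 2 := by
      rw [div_le_div_iff₀ (by positivity) (by norm_num)]
      have : (0 : ℝ) ≤ j := by positivity
      nlinarith [mul_nonneg this this]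
    exact_mod_cast (by linarith : (blockCount C θ j : ℝ) < (C j).length)
  calc blockCount C θ j * wordLength l₁ C j < (C j).length * wordLength l₁ C j :=
        Nat.mul_lt_mul_of_pos_right h1 (hC.wordLength_pos j)
    _ = wordLength l₁ C (j + 1) := rfl
    _ ≤ blockCount C θ (j + 1) * wordLength l₁ C (j + 1) :=
        Nat.le_mul_of_pos_left _ (Nat.succ_pos _)

lemma four_mul_sq_le_length (hC : IsMarkerConstruction l₁ C) (hl₁ : 25 ≤ l₁) {j : ℕ}
    (hj : 10 ≤ j) : 4 * ((j : ℝ) + 3) ^ 2 ≤ (C j).length := by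
  have h1 := (sq_mul_le_two_pow hj).trans (hC.two_pow_le_length hl₁ j)
  exact_mod_cast (Nat.mul_le_mul_left 4 (Nat.pow_le_pow_left (by omega) 2)).trans h1

lemma four_mul_sq_le_wordLength (hC : IsMarkerConstruction l₁ C) (hl₁ : 25 ≤ l₁) {j : ℕ}
    (hj : 10 ≤ j) : 4 * ((j : ℝ) + 3) ^ 2 ≤ wordLength l₁ C j := by
  have h1 := sq_mul_le_two_pow hj
  have h2 : 2 ^ j ≤ 32 ^ j := Nat.pow_le_pow_left (by norm_num) j
  have h3 := hC.le_wordLength hl₁ j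
  have h4 : 4 * (j + 3) ^ 2 ≤ 4 * (j + 4) ^ 2 :=
    Nat.mul_le_mul_left 4 (Nat.pow_le_pow_left (by omega) 2)
  exact_mod_cast (by omega : 4 * (j + 3) ^ 2 ≤ wordLength l₁ C j)

/-- The denominator in `blockCount` serves this bound: the window fits into the distance that
genericity leaves to the right end of the word of level j + 1. -/
lemma blockCount_mul_le (hC : IsMarkerConstruction l₁ C) (hl₁ : 25 ≤ l₁) {θ : ℝ} (hθ : θ ≤ 1)
    {j : ℕ} (hj : 10 ≤ j) : blockCount C θ j * (j + 3) ^ 2 ≤ (C j).length := by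
  have h1 := blockCount_le (C := C) θ j
  have h2 := hC.rpow_le_length hθ j
  have h3 := hC.four_mul_sq_le_length hl₁ hj
  have hD : (0 : ℝ) < ((j : ℝ) + 3) ^ 2 := by positivity
  have h4 : (blockCount C θ j : ℝ) * ((j : ℝ) + 3) ^ 2 ≤ (C j).length := by
    calc _ ≤ (((C j).length : ℝ) ^ θ / (4 * (j + 3) ^ 2) + 1) * ((j : ℝ) + 3) ^ 2 := by gcongr
      _ = ((C j).length : ℝ) ^ θ / 4 + ((j : ℝ) + 3) ^ 2 := by field_simp
      _ ≤ _ := by linarith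
  exact_mod_cast h4

lemma add_le_of_isGeneric (hC : IsMarkerConstruction l₁ C) (hl₁ : 25 ≤ l₁) {θ : ℝ} (hθ : θ ≤ 1)
    {j : ℕ} (hj : 10 ≤ j) {r : ℕ}
    (hr : r + wordLength l₁ C (j + 1) / (j + 1 + 2) ^ 2 ≤ wordLength l₁ C (j + 1)) :
    r + blockCount C θ j * wordLength l₁ C j ≤ wordLength l₁ C (j + 1) := by
  have : blockCount C θ j * wordLength l₁ C j ≤ wordLength l₁ C (j + 1) / (j + 1 + 2) ^ 2 := by
    rw [Nat.le_div_iff_mul_le (by positivity), mul_right_comm]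
    exact Nat.mul_le_mul_right _ (hC.blockCount_mul_le hl₁ hθ hj)
  omega

lemma info_blockCount_le (hC : IsMarkerConstruction l₁ C) (hl₁ : 25 ≤ l₁)
    (hμ : IsInvariantProbabilityOn (generatedSubshift C) μ) {θ : ℝ} (hθ0 : 1 / 2 ≤ θ) (hθ : θ ≤ 1)
    {j : ℕ} (hj : 10 ≤ j) {x : ℤ → Bool} (hx : IsGeneric l₁ C (j + 1) x) :
    0 < μ.real (cylinderAt (generatedSubshift C) (blockCount C θ j * wordLength l₁ C j) x) ∧
    info C μ x (blockCount C θ j * wordLength l₁ C j) ≤ Real.log (wordLength l₁ C j) +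
      6 * (((C j).length : ℝ) ^ (θ - 1 / 2) * Real.log (C j).length) := by
  obtain ⟨r, hr, hr1, hr2⟩ := hx
  obtain ⟨hpos, hle⟩ := hC.info_le hμ hr (hC.add_le_of_isGeneric hl₁ hθ hj hr2)
  refine ⟨hpos, hle.trans ?_⟩
  have hq := blockCount_le (C := C) θ j
  have hDN := hC.four_mul_sq_le_length hl₁ hj
  have hN1 := hC.one_le_length j
  rw [hC.log_wordLength_succ]
  have hh : (0 : ℝ) < wordLength l₁ C j := by exact_mod_cast hC.wordLength_pos j
  have hrD : (C j).length * wordLength l₁ C j ≤ (r + 1) * (j + 3) ^ 2 := by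
    have h1 : wordLength l₁ C (j + 1) / (j + 1 + 2) ^ 2 < r + 1 := by omega
    have h2 := (Nat.div_lt_iff_lt_mul (by positivity)).1 h1
    exact h2.le
  have hrD : ((C j).length : ℝ) * wordLength l₁ C j ≤ (r + 1) * ((j : ℝ) + 3) ^ 2 := by
    exact_mod_cast hrD
  have hh1 : (1 : ℝ) ≤ wordLength l₁ C j := by exact_mod_cast hC.wordLength_pos j
  set N := ((C j).length : ℝ) with hN
  set h := (wordLength l₁ C j : ℝ) with hhdef
  set q := (blockCount C θ j : ℝ) with hqdef
  set d := (j : ℝ) + 3 with hd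
  have hd1 : 1 ≤ d := by rw [hd]; linarith [Nat.cast_nonneg (α := ℝ) j]
  have hd0 : 0 < d := by linarith
  have hq0 : 0 ≤ q := Nat.cast_nonneg _
  push_cast
  rw [← hqdef, ← hhdef, add_div, mul_div_assoc, div_self hh.ne', mul_one]
  -- Genericity on the left keeps r/h of order N up to d^2. There the square root has slope of order
  -- 1/√N up to d, so q blocks meet only about N^{θ-1/2} permuted positions.
  have hA : N / (4 * d ^ 2) ≤ r / h := by
    rw [div_le_div_iff₀ (by positivity) hh]
    nlinarith
  have hsA : √N / (2 * d) ≤ √(r / h) := by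
    rw [show √N / (2 * d) = √(N / (4 * d ^ 2)) by
      rw [Real.sqrt_div (by linarith), show 4 * d ^ 2 = (2 * d) ^ 2 by ring,
        Real.sqrt_sq (by positivity)]]
    exact Real.sqrt_le_sqrt hA
  have hsN : 2 * d ≤ √N := Real.le_sqrt_of_sq_le (by linarith)
  have hsN0 : 0 < √N := by linarith
  have hsr : 0 < √(r / h) := lt_of_lt_of_le (by positivity) hsA
  have hdiff : √(r / h + q + 1) - √(r / h) ≤ (q + 1) / √(r / h) := by
    rw [le_div_iff₀ hsr]
    have e1 := Real.sq_sqrt (show 0 ≤ (r : ℝ) / h by positivity)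
    have e2 := Real.sq_sqrt (show 0 ≤ (r : ℝ) / h + q + 1 by positivity)
    have e3 : √(r / h) ≤ √(r / h + q + 1) := Real.sqrt_le_sqrt (by linarith)
    nlinarith [mul_self_nonneg (√(r / h + q + 1) - √(r / h))]
  have hNa : N ^ θ = N ^ (θ - 1 / 2) * √N := by
    rw [Real.sqrt_eq_rpow, ← Real.rpow_add (by linarith)]
    congr 1; ring
  have hNa1 : 1 ≤ N ^ (θ - 1 / 2) := Real.one_le_rpow hN1 (by linarith)
  have hbound : (q + 1) / √(r / h) ≤ N ^ (θ - 1 / 2) + 2 := by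
    calc (q + 1) / √(r / h) ≤ (N ^ θ / (4 * d ^ 2) + 2) / (√N / (2 * d)) := by
          exact div_le_div₀ (by positivity) (by linarith) (by positivity) hsA
      _ = N ^ (θ - 1 / 2) / (2 * d) + 2 * ((2 * d) / √N) := by
          rw [hNa]; field_simp; ring
      _ ≤ N ^ (θ - 1 / 2) + 2 * 1 := by
          gcongr
          · exact div_le_self (by linarith) (by linarith)
          · exact (div_le_one hsN0).2 hsN
      _ = _ := by ring
  have hlN : 0 ≤ Real.log N := Real.log_nonneg hN1
  have hfin : (√(r / h + q + 1) - √(r / h) + 2) * Real.log N ≤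
      (5 * N ^ (θ - 1 / 2)) * Real.log N := by
    gcongr
    linarith
  have : Real.log N ≤ N ^ (θ - 1 / 2) * Real.log N := le_mul_of_one_le_left hlN hNa1
  linarith

lemma le_info_blockCount (hC : IsMarkerConstruction l₁ C) (hl₁ : 25 ≤ l₁)
    (hμ : IsInvariantProbabilityOn (generatedSubshift C) μ) {θ : ℝ} (hθ : θ ≤ 1)
    {j : ℕ} (hj : 10 ≤ j) {x : ℤ → Bool} (hx : IsGeneric l₁ C (j + 1) x) :
    (((C j).length : ℝ) ^ (θ - 1 / 2) / (8 * (j + 3) ^ 2) - 4) * Real.log 2 ≤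
      info C μ x (blockCount C θ j * wordLength l₁ C j) := by
  have hl2 : 0 ≤ Real.log 2 := Real.log_nonneg (by norm_num)
  have hN1 := hC.one_le_length j
  have hN0 : (0 : ℝ) < (C j).length := by linarith
  have hNa : ((C j).length : ℝ) ^ θ = ((C j).length : ℝ) ^ (θ - 1 / 2) * √((C j).length : ℝ) := by
    rw [Real.sqrt_eq_rpow, ← Real.rpow_add hN0]
    congr 1; ring
  have hNa0 : 0 ≤ ((C j).length : ℝ) ^ (θ - 1 / 2) := by positivity
  have hs1 : 1 ≤ √((C j).length : ℝ) := Real.one_le_sqrt.2 hN1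
  have hq := le_blockCount (C := C) θ j
  have hd0 : (0 : ℝ) < (j : ℝ) + 3 := by positivity
  -- For fewer than three blocks `le_info` does not apply, but then the left side is nonpositive.
  by_cases h3 : 3 ≤ blockCount C θ j
  · obtain ⟨r, hr, hr1, hr2⟩ := hx
    have hrn := hC.add_le_of_isGeneric hl₁ hθ hj hr2
    refine le_trans (mul_le_mul_of_nonneg_right ?_ hl2)
      (hC.le_info hμ hr hrn (Nat.mul_le_mul_right _ h3))
    have hh : (0 : ℝ) < wordLength l₁ C j := by exact_mod_cast hC.wordLength_pos j
    have hrnR : (r : ℝ) + blockCount C θ j * wordLength l₁ C j ≤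
        (C j).length * wordLength l₁ C j := by exact_mod_cast hrn
    have h3' : (3 : ℝ) ≤ blockCount C θ j := by exact_mod_cast h3
    push_cast
    set N := ((C j).length : ℝ) with hN
    set h := (wordLength l₁ C j : ℝ) with hhdef
    set q := (blockCount C θ j : ℝ) with hqdef
    have hBN : (r + q * h) / h ≤ N := (div_le_iff₀ hh).2 hrnR
    rw [add_div, mul_div_assoc, div_self hh.ne', mul_one] at hBN ⊢
    have hrh : 0 ≤ (r : ℝ) / h := by positivity
    have e1 := Real.sq_sqrt (show 0 ≤ (r : ℝ) / h + 1 by positivity)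
    have e2 := Real.sq_sqrt (show 0 ≤ (r : ℝ) / h + q by positivity)
    have e3 : √(r / h + 1) ≤ √(r / h + q) := Real.sqrt_le_sqrt (by linarith)
    have e4 : √(r / h + q) ≤ √N := Real.sqrt_le_sqrt hBN
    have hsN0 : 0 < √N := by linarith
    have hdiff : (q - 1) / (2 * √N) ≤ √(r / h + q) - √(r / h + 1) := by
      rw [div_le_iff₀ (by positivity)]
      have : (√(r / h + q) - √(r / h + 1)) * (√(r / h + q) + √(r / h + 1)) = q - 1 := by
        ring_nf; ring_nf at e1 e2; linarith
      rw [← this]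
      exact mul_le_mul_of_nonneg_left (by linarith) (by linarith)
    have hlow : N ^ (θ - 1 / 2) / (8 * ((j : ℝ) + 3) ^ 2) - 1 ≤ (q - 1) / (2 * √N) := by
      rw [le_div_iff₀ (by positivity), sub_mul]
      have : N ^ (θ - 1 / 2) / (8 * ((j : ℝ) + 3) ^ 2) * (2 * √N) =
          N ^ θ / (4 * ((j : ℝ) + 3) ^ 2) := by
        rw [hNa]; field_simp; norm_num
      rw [this]
      linarith
    linarith
  · have hqle : (blockCount C θ j : ℝ) ≤ 2 := by exact_mod_cast (by omega : blockCount C θ j ≤ 2)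
    refine le_trans (mul_nonpos_of_nonpos_of_nonneg ?_ hl2) (info_nonneg hμ _ _)
    have h5 : ((C j).length : ℝ) ^ (θ - 1 / 2) / (8 * ((j : ℝ) + 3) ^ 2) ≤
        ((C j).length : ℝ) ^ θ / (4 * ((j : ℝ) + 3) ^ 2) := by
      apply div_le_div₀ (by positivity) _ (by positivity) (by nlinarith)
      rw [hNa]
      exact le_mul_of_one_le_right hNa0 hs1
    linarith

lemma tendsto_info_blockCount_zero (hC : IsMarkerConstruction l₁ C) (hl₁ : 25 ≤ l₁)
    (hμ : IsInvariantProbabilityOn (generatedSubshift C) μ) {θ β : ℝ} (hθ0 : 1 / 2 ≤ θ)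
    (hθ : θ ≤ 1) (hβ0 : 0 < β) (hβ : θ - 1 / 2 < θ * β) {x : ℤ → Bool}
    (hx : ∀ᶠ j in atTop, IsGeneric l₁ C j x) :
    Tendsto (fun j => info C μ x (blockCount C θ j * wordLength l₁ C j) /
      ((blockCount C θ j * wordLength l₁ C j : ℕ) : ℝ) ^ β) atTop (𝓝 0) := by
  have hlim1 : Tendsto (fun j => Real.log (wordLength l₁ C j) / (wordLength l₁ C j : ℝ) ^ β)
      atTop (𝓝 0) :=
    (tendsto_log_div_rpow hβ0).comp
      (tendsto_natCast_atTop_atTop.comp (hC.tendsto_wordLength hl₁))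
  have hlim2 : Tendsto (fun j => 6 * (Real.log (C j).length /
      ((C j).length : ℝ) ^ (θ * β - (θ - 1 / 2)))) atTop (𝓝 (6 * 0)) :=
    ((tendsto_log_div_rpow (by linarith)).comp (hC.tendsto_length hl₁)).const_mul 6
  have hlim := hlim1.add hlim2
  rw [mul_zero, add_zero] at hlim
  refine squeeze_zero' (Eventually.of_forall fun j => div_nonneg (info_nonneg hμ _ _)
    (by positivity)) ?_ hlim
  filter_upwards [(tendsto_add_atTop_nat 1).eventually hx, eventually_ge_atTop 10] with j hj hj10
  have hinfo := (hC.info_blockCount_le hl₁ hμ hθ0 hθ hj10 hj).2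
  have hh : (0 : ℝ) < wordLength l₁ C j := by exact_mod_cast hC.wordLength_pos j
  have hh1 : (1 : ℝ) ≤ wordLength l₁ C j := by exact_mod_cast hC.wordLength_pos j
  have hN1 := hC.one_le_length j
  have hN0 : (0 : ℝ) < (C j).length := by linarith
  have hlN : 0 ≤ Real.log (C j).length := Real.log_nonneg hN1
  have hlh : 0 ≤ Real.log (wordLength l₁ C j) := Real.log_nonneg hh1
  -- Two lower bounds for n are used separately: n ≥ H_j handles the term log H_j, and n ≥ N_j^θ
  -- handles the count of permuted positions.
  have hn1 : (wordLength l₁ C j : ℝ) ≤ ((blockCount C θ j * wordLength l₁ C j : ℕ) : ℝ) := by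
    exact_mod_cast Nat.le_mul_of_pos_left _ (Nat.succ_pos _)
  have hn2 : ((C j).length : ℝ) ^ θ ≤ ((blockCount C θ j * wordLength l₁ C j : ℕ) : ℝ) := by
    have h1 := le_blockCount (C := C) θ j
    have h2 := hC.four_mul_sq_le_wordLength hl₁ hj10
    have hd0 : (0 : ℝ) < 4 * ((j : ℝ) + 3) ^ 2 := by positivity
    rw [div_le_iff₀ hd0] at h1
    push_cast
    exact h1.trans (by gcongr)
  calc _ ≤ (Real.log (wordLength l₁ C j) +
        6 * (((C j).length : ℝ) ^ (θ - 1 / 2) * Real.log (C j).length)) /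
        ((blockCount C θ j * wordLength l₁ C j : ℕ) : ℝ) ^ β := by gcongr
    _ = Real.log (wordLength l₁ C j) / ((blockCount C θ j * wordLength l₁ C j : ℕ) : ℝ) ^ β +
        6 * (((C j).length : ℝ) ^ (θ - 1 / 2) * Real.log (C j).length) /
        ((blockCount C θ j * wordLength l₁ C j : ℕ) : ℝ) ^ β := add_div _ _ _
    _ ≤ Real.log (wordLength l₁ C j) / (wordLength l₁ C j : ℝ) ^ β +
        6 * (((C j).length : ℝ) ^ (θ - 1 / 2) * Real.log (C j).length) /
        (((C j).length : ℝ) ^ θ) ^ β := by gcongr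
    _ = _ := by
        rw [← Real.rpow_mul hN0.le, Real.rpow_sub hN0 (θ * β)]
        field_simp

lemma tendsto_info_blockCount_atTop (hC : IsMarkerConstruction l₁ C) (hl₁ : 25 ≤ l₁)
    (hsq : IsSquare l₁)
    (hμ : IsInvariantProbabilityOn (generatedSubshift C) μ) {θ β : ℝ} (hθ0 : 1 / 2 ≤ θ)
    (hθ : θ ≤ 1) (hβ0 : 0 < β) (hβ1 : β ≤ 1) (hβ : θ * β < θ - 1 / 2) {x : ℤ → Bool}
    (hx : ∀ᶠ j in atTop, IsGeneric l₁ C j x) :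
    Tendsto (fun j => info C μ x (blockCount C θ j * wordLength l₁ C j) /
      ((blockCount C θ j * wordLength l₁ C j : ℕ) : ℝ) ^ β) atTop atTop := by
  set δ := θ - 1 / 2 - θ * β with hδ
  have hδ0 : 0 < δ := by linarith
  have hl2 : 0 < Real.log 2 := Real.log_pos (by norm_num)
  have hlim : Tendsto (fun j => (((C j).length : ℝ) ^ (δ / 2) / 16 - 4) * Real.log 2)
      atTop atTop := by
    refine Tendsto.atTop_mul_const hl2 ?_
    exact tendsto_atTop_add_const_right _ (-4) (((tendsto_rpow_atTop (by linarith)).comp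
      (hC.tendsto_length hl₁)).atTop_div_const (by norm_num))
  refine tendsto_atTop_mono' _ ?_ hlim
  filter_upwards [(tendsto_add_atTop_nat 1).eventually hx, eventually_ge_atTop 10,
    hC.eventually_wordLength_le_rpow hl₁ hsq (show 0 < δ / 4 by linarith)] with j hj hj10 hjW
  have hinfo := hC.le_info_blockCount hl₁ hμ hθ hj10 hj
  have hh1 : (1 : ℝ) ≤ wordLength l₁ C j := by exact_mod_cast hC.wordLength_pos j
  have hh0 : (0 : ℝ) < wordLength l₁ C j := by linarith
  have hN1 := hC.one_le_length j
  have hN0 : (0 : ℝ) < (C j).length := by linarith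
  have hDh := hC.four_mul_sq_le_wordLength hl₁ hj10
  have hn1 : (1 : ℝ) ≤ ((blockCount C θ j * wordLength l₁ C j : ℕ) : ℝ) := by
    exact_mod_cast Nat.mul_pos (Nat.succ_pos _) (hC.wordLength_pos j)
  have hNθ : 1 ≤ ((C j).length : ℝ) ^ θ := Real.one_le_rpow hN1 (by linarith)
  have hnup : ((blockCount C θ j * wordLength l₁ C j : ℕ) : ℝ) ≤
      (2 * wordLength l₁ C j) * ((C j).length : ℝ) ^ θ := by
    have h1 := blockCount_le (C := C) θ j
    have h2 : ((C j).length : ℝ) ^ θ / (4 * ((j : ℝ) + 3) ^ 2) ≤ ((C j).length : ℝ) ^ θ := by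
      refine div_le_self (by linarith) ?_
      nlinarith [Nat.cast_nonneg (α := ℝ) j]
    push_cast
    have h3 : (blockCount C θ j : ℝ) ≤ 2 * ((C j).length : ℝ) ^ θ := by linarith
    calc _ ≤ 2 * ((C j).length : ℝ) ^ θ * wordLength l₁ C j := by gcongr
      _ = _ := by ring
  have hpow : ((blockCount C θ j * wordLength l₁ C j : ℕ) : ℝ) ^ β ≤
      2 * wordLength l₁ C j * ((C j).length : ℝ) ^ (θ * β) := by
    calc _ ≤ ((2 * wordLength l₁ C j) * ((C j).length : ℝ) ^ θ) ^ β := by gcongr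
      _ = (2 * wordLength l₁ C j) ^ β * ((C j).length : ℝ) ^ (θ * β) := by
          rw [Real.mul_rpow (by positivity) (by positivity), ← Real.rpow_mul hN0.le]
      _ ≤ _ := by
          gcongr
          simpa using Real.rpow_le_rpow_of_exponent_le
            (by linarith : (1 : ℝ) ≤ 2 * wordLength l₁ C j) hβ1
  have hnβ1 : 1 ≤ ((blockCount C θ j * wordLength l₁ C j : ℕ) : ℝ) ^ β :=
    Real.one_le_rpow hn1 hβ0.le
  set Y := ((blockCount C θ j * wordLength l₁ C j : ℕ) : ℝ) ^ β with hY
  have hY0 : 0 < Y := by linarith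
  rw [le_div_iff₀ hY0]
  refine le_trans ?_ hinfo
  rw [mul_right_comm]
  gcongr
  rw [sub_mul]
  have hmain : ((C j).length : ℝ) ^ (δ / 2) / 16 * Y ≤
      ((C j).length : ℝ) ^ (θ - 1 / 2) / (8 * ((j : ℝ) + 3) ^ 2) := by
    rw [le_div_iff₀ (by positivity)]
    -- The surplus δ is split: two factors N^{δ/4} absorb H_j from n^β and the polynomial factor,
    -- and N^{δ/2} is left to diverge.
    have e1 : ((C j).length : ℝ) ^ (θ - 1 / 2) = ((C j).length : ℝ) ^ (δ / 2) *
        (((C j).length : ℝ) ^ (δ / 4) * ((C j).length : ℝ) ^ (δ / 4)) *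
        ((C j).length : ℝ) ^ (θ * β) := by
      rw [← Real.rpow_add hN0, ← Real.rpow_add hN0, ← Real.rpow_add hN0]
      congr 1
      rw [hδ]; ring
    rw [e1]
    calc _ ≤ ((C j).length : ℝ) ^ (δ / 2) / 16 *
          (2 * wordLength l₁ C j * ((C j).length : ℝ) ^ (θ * β)) *
          (2 * wordLength l₁ C j) :=
          mul_le_mul (by gcongr) (by linarith) (by positivity) (by positivity)
      _ = ((C j).length : ℝ) ^ (δ / 2) * (wordLength l₁ C j * wordLength l₁ C j) *
          ((C j).length : ℝ) ^ (θ * β) * (1 / 4) := by ring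
      _ ≤ ((C j).length : ℝ) ^ (δ / 2) *
        (((C j).length : ℝ) ^ (δ / 4) * ((C j).length : ℝ) ^ (δ / 4)) *
        ((C j).length : ℝ) ^ (θ * β) * 1 := by
          gcongr
          norm_num
      _ = _ := mul_one _
  linarith

/-- Along the windows with `blockCount C θ j` blocks, the exponent of the information of a generic
point is `(θ - 1 / 2) / θ`. -/
lemma limHasCriticalValue_blockCount (hC : IsMarkerConstruction l₁ C) (hl₁ : 25 ≤ l₁)
    (hsq : IsSquare l₁) (hμ : IsInvariantProbabilityOn (generatedSubshift C) μ) {θ τ : ℝ}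
    (hθ0 : 1 / 2 ≤ θ) (hθ : θ ≤ 1) (hτ1 : τ ≤ 1) (hτ : θ * τ = θ - 1 / 2) {x : ℤ → Bool}
    (hx : ∀ᶠ j in atTop, IsGeneric l₁ C j x) :
    LimHasCriticalValue (fun β j => atomRate (generatedSubshift C) μ x β
      (blockCount C θ j * wordLength l₁ C j)) τ := by
  intro β hβ
  have heq : (fun j => ((info C μ x (blockCount C θ j * wordLength l₁ C j) /
      ((blockCount C θ j * wordLength l₁ C j : ℕ) : ℝ) ^ β : ℝ) : EReal)) =ᶠ[atTop]
      fun j => atomRate (generatedSubshift C) μ x β (blockCount C θ j * wordLength l₁ C j) := by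
    filter_upwards [(tendsto_add_atTop_nat 1).eventually hx, eventually_ge_atTop 10] with j hj hj10
    rw [atomRate_eq hμ (hC.info_blockCount_le hl₁ hμ hθ0 hθ hj10 hj).1]
  constructor
  · intro hτβ
    refine Tendsto.congr' heq ?_
    rw [← EReal.coe_zero]
    refine (continuous_coe_real_ereal.tendsto 0).comp
      (hC.tendsto_info_blockCount_zero hl₁ hμ hθ0 hθ hβ ?_ hx)
    rw [← hτ]
    exact mul_lt_mul_of_pos_left hτβ (by linarith)
  · intro hβτ
    refine Tendsto.congr' heq ?_
    refine EReal.tendsto_coe_nhds_top_iff.2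
      (hC.tendsto_info_blockCount_atTop hl₁ hsq hμ hθ0 hθ hβ (by linarith) ?_ hx)
    rw [← hτ]
    exact mul_lt_mul_of_pos_left hβτ (by linarith)

end IsMarkerConstruction

/-! ### Assembly of the theorem -/

theorem theorem4p4 (l₁ : ℕ) (hsq : IsSquare l₁) (hl₁ : 25 ≤ l₁)
    (C : ℕ → List (List Bool)) (hC : IsMarkerConstruction l₁ C) :
    ∃ μ : Measure (ℤ → Bool),
      IsInvariantProbabilityOn (generatedSubshift C) μ ∧
      (∀ ν : Measure (ℤ → Bool), IsInvariantProbabilityOn (generatedSubshift C) ν → ν = μ) ∧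
      (∀ᵐ x ∂μ, LimsupHasCriticalValue (atomRate (generatedSubshift C) μ x) (1 / 2)) ∧
      (∃ Xhat : Set (ℤ → Bool), Xhat ⊆ generatedSubshift C ∧ μ Xhatᶜ = 0 ∧
        ∀ τ ∈ Set.Icc (0 : ℝ) (1 / 2), ∃ n : ℕ → ℕ, StrictMono n ∧
          ∀ x ∈ Xhat, LimHasCriticalValue
            (fun β j => atomRate (generatedSubshift C) μ x β (n j)) τ) := by
  obtain ⟨μ, hμ⟩ := hC.exists_invariant hl₁
  have hae := hC.ae_eventually_isGeneric hμ
  refine ⟨μ, hμ, fun ν hν => hC.invariant_unique hl₁ hμ hν, ?_, ?_⟩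
  · filter_upwards [hae] with x hx β hβ
    refine ⟨fun h => (hC.tendsto_atomRate_zero hl₁ hμ hx.2 h).limsup_eq, fun h => ?_⟩
    -- For β < 1/2 the windows with θ = 1 already have rate tending to ∞, which forces the limit
    -- superior.
    have hmono := hC.strictMono_blockCount_mul hl₁ (le_refl (1 : ℝ))
    have hlim := (hC.limHasCriticalValue_blockCount hl₁ hsq hμ (θ := 1) (τ := 1 / 2)
      (by norm_num) le_rfl (by norm_num) (by norm_num) hx.2 β hβ).2 h
    refine top_le_iff.1 (hlim.limsup_eq.symm.le.trans ?_)
    exact limsup_le_limsup_of_le hmono.tendsto_atTop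
  · refine ⟨{x | x ∈ generatedSubshift C ∧ ∀ᶠ j in atTop, IsMarkerConstruction.IsGeneric l₁ C j x},
      fun x hx => hx.1, hae, ?_⟩
    rintro τ ⟨hτ0, hτ1⟩
    have hpos : 0 < 2 * (1 - τ) := by linarith
    -- This θ solves (θ - 1/2)/θ = τ. Genericity does not involve θ, so one conull set serves every
    -- τ.
    have hθ1 : 1 / (2 * (1 - τ)) ≤ 1 := by rw [div_le_one hpos]; linarith
    refine ⟨_, hC.strictMono_blockCount_mul hl₁ hθ1, fun x hx => ?_⟩
    refine hC.limHasCriticalValue_blockCount hl₁ hsq hμ ?_ hθ1 (by linarith) ?_ hx.2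
    · rw [div_le_div_iff₀ (by norm_num) hpos]; linarith
    · have : 1 - τ ≠ 0 := by linarith
      field_simp
      ring
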